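/- Let $M$ be a smooth (finite-dimensional) manifold and let $(M,\omega)$ be pre-$n$-plectic, i.e. $\omega\in\Omega^{n+1}(M)$ is closed. Let $H\in\Omega^{n-1}(M)$ be a Hamiltonian form, i.e. there is a vector field $v_H$ (a Hamiltonian vector field of $H$) with $dH=-\iota_{v_H}\omega$. Let $\mathfrak g$ be a real Lie algebra and let $\mathfrak g\to\mathfrak X(M)$, $x\mapsto v_x$, be a homomorphism of Lie algebras with $\mathcal L_{v_x}\omega=0$ for all $x\in\mathfrak g$, which is locally $H$-preserving: $\mathcal L_{v_x}H$ is closed for all $x\in\mathfrak g$. Notation. For $p=x_1\wedge\dots\wedge x_k\in\Lambda^k\mathfrak g$ put $v_p=v_{x_1}\wedge\dots\wedge v_{x_k}$ and $\iota(v_p)=\iota_{v_{x_k}}\cdots\iota_{v_{x_1}}$, extended linearly to $\Lambda^k\mathfrak g$. For an $m$-vector field $Y$ and a form $\alpha$ put $\mathcal L_Y\alpha=d\iota_Y\alpha-(-1)^m\iota_Yd\alpha$. Let $\partial\colon\Lambda^k\mathfrak g\to\Lambda^{k-1}\mathfrak g$, $x_1\wedge\dots\wedge x_k\mapsto\sum_{i<j}(-1)^{i+j}[x_i,x_j]\wedge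 x_1\wedge\dots\hat x_i\dots\hat x_j\dots\wedge x_k$, be the Lie algebra homology differential, with cycles $Z_k(\mathfrak g)=\ker\partial|_{\Lambda^k\mathfrak g}$, boundaries $B_k(\mathfrak g)=\partial(\Lambda^{k+1}\mathfrak g)$ and homology $H_k(\mathfrak g)=Z_k(\mathfrak g)/B_k(\mathfrak g)$. Put $\varsigma(k)=-(-1)^{k(k+1)/2}$. A (homotopy) co-momentum map is a family of linear maps $f_i\colon\Lambda^i\mathfrak g\to\Omega^{n-i}(M)$, $1\le i\le n$, such that every $f_1(x)$ is Hamiltonian with $d f_1(x)=-\iota_{v_x}\omega$ and $$-f_{k-1}(\partial p)=df_k(p)+\varsigma(k)\,\iota(v_p)\omega\qquad\text{for all }1\le k\le n+1,\ p\in\Lambda^k\mathfrak g,$$ where $f_0=0$ and $f_{n+1}=0$. Forms of negative degree are zero, and we also put $f_i=0$ for $i>n$. Claim. For every $k\ge1$ the following hold. 1. The map $$A\colon H_k(\mathfrak g)\to H^{n-k}_{dR}(M),\qquad [p]\mapsto[\mathcal L_{v_p}H],$$ is well defined and linear: $\mathcal L_{v_p}H$ is a closed $(n-k)$-form for every $p\in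 Z_k(\mathfrak g)$, and its class depends only on $[p]$. 2. If $(f_i)$ is a co-momentum map for the action and $v_H$ is any Hamiltonian vector field of $H$, then for every $p\in Z_k(\mathfrak g)$ the form $\mathcal L_{v_H}f_k(p)$ is closed and $$A([p])=-\varsigma(k)\,[\mathcal L_{v_H}f_k(p)].$$ -/

import Mathlib

open scoped Manifold ContDiff Topology

noncomputable section

namespace MultiSymp

/-- The quotient `Z / (B ∩ Z)` of two subspaces of a real vector space. -/
abbrev Subquotient {V : Type*} [AddCommGroup V] [Module ℝ V] (Z B : Submodule ℝ V) : Type _ :=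
  Z ⧸ B.submoduleOf Z

/-- The class in `Z / (B ∩ Z)` of an element of `Z`. -/
def Subquotient.mk {V : Type*} [AddCommGroup V] [Module ℝ V] {Z B : Submodule ℝ V} :
    Z →ₗ[ℝ] Subquotient Z B :=
  Submodule.mkQ _

/-! ### Lie algebra homology -/

section LieHomology

variable (𝔤 : Type*) [LieRing 𝔤] [LieAlgebra ℝ 𝔤]

/-- The alternating map
`(x₁, …, x_{k+2}) ↦ ∑_{i<j} (-1)^{i+j} [xᵢ, xⱼ] ∧ x₁ ∧ ⋯ x̂ᵢ ⋯ x̂ⱼ ⋯ ∧ x_{k+2}`.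
It is obtained by alternating `(x, y; z) ↦ [x, y] ∧ z` in `x` and `y`; the factor `1/2` appears
because every pair is counted twice. The explicit formula is `boundaryAlt_apply`. -/
def boundaryAlt (k : ℕ) : 𝔤 [⋀^Fin (k + 2)]→ₗ[ℝ] (⋀[ℝ]^(k + 1) 𝔤) :=
  (-(1 / 2) : ℝ) •
    AlternatingMap.alternatizeUncurryFin (AlternatingMap.alternatizeUncurryFinLM ∘ₗ
      LinearMap.compr₂ (LieModule.toEnd ℝ 𝔤 𝔤 : 𝔤 →ₗ[ℝ] 𝔤 →ₗ[ℝ] 𝔤)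
        (AlternatingMap.curryLeft (exteriorPower.ιMulti ℝ (k + 1))))

theorem boundaryAlt_aux {V : Type*} [AddCommGroup V] [Module ℝ V] (l : ℕ) (y : V) :
    (-(1 / 2) : ℝ) • ((-1 : ℤ) ^ l • ((2 : ℝ) • y)) = -((-1 : ℝ) ^ l • y) := by
  rcases Nat.even_or_odd l with hp | hp
  · rw [hp.neg_one_pow, hp.neg_one_pow]
    module
  · rw [hp.neg_one_pow, hp.neg_one_pow]
    module

/-- The explicit formula. The index pair `(i, j)`, `i ≤ j`, stands for the positions
`i.castSucc < j.succ`, numbered from `0`; numbered from `1` they are `i + 1` and `j + 2`,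
whence the global minus sign. -/
theorem boundaryAlt_apply (k : ℕ) (x : Fin (k + 2) → 𝔤) :
    boundaryAlt 𝔤 k x =
      -∑ i : Fin (k + 1), ∑ j ≥ i, (-1 : ℝ) ^ (i + j : ℕ) •
        exteriorPower.ιMulti ℝ (k + 1)
          (Matrix.vecCons ⁅x i.castSucc, x j.succ⁆ (j.removeNth (i.castSucc.removeNth x))) := by
  rw [boundaryAlt, AlternatingMap.smul_apply,
    AlternatingMap.alternatizeUncurryFin_alternatizeUncurryFinLM_comp_apply,
    Finset.smul_sum, ← Finset.sum_neg_distrib]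
  refine Finset.sum_congr rfl fun i _ => ?_
  rw [Finset.smul_sum, ← Finset.sum_neg_distrib]
  refine Finset.sum_congr rfl fun j _ => ?_
  have h : ∀ (a b : 𝔤) (z : Fin k → 𝔤),
      (LinearMap.compr₂ (LieModule.toEnd ℝ 𝔤 𝔤 : 𝔤 →ₗ[ℝ] 𝔤 →ₗ[ℝ] 𝔤)
        (AlternatingMap.curryLeft (exteriorPower.ιMulti ℝ (k + 1)))) a b z =
      exteriorPower.ιMulti ℝ (k + 1) (Matrix.vecCons ⁅a, b⁆ z) := fun a b z => rfl
  have h2 : ∀ (a b : 𝔤) (z : Fin k → 𝔤),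
      exteriorPower.ιMulti ℝ (k + 1) (Matrix.vecCons ⁅b, a⁆ z) =
        -exteriorPower.ιMulti ℝ (k + 1) (Matrix.vecCons ⁅a, b⁆ z) := by
    intro a b z
    have h3 : ⁅b, a⁆ = -⁅a, b⁆ := (lie_skew b a).symm
    change AlternatingMap.curryLeft (exteriorPower.ιMulti ℝ (k + 1)) ⁅b, a⁆ z =
      -AlternatingMap.curryLeft (exteriorPower.ιMulti ℝ (k + 1)) ⁅a, b⁆ z
    rw [h3, map_neg]
    rfl
  rw [h, h, h2 (x i.castSucc) (x j.succ), sub_neg_eq_add, ← two_smul ℝ]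
  exact boundaryAlt_aux _ _

/-- The Lie algebra homology differential `∂_{k+1} : Λ^{k+1} 𝔤 → Λ^k 𝔤`; in particular `∂₁ = 0`. -/
def boundary : (k : ℕ) → (⋀[ℝ]^(k + 1) 𝔤) →ₗ[ℝ] (⋀[ℝ]^k 𝔤)
  | 0 => 0
  | k + 1 => exteriorPower.alternatingMapLinearEquiv (boundaryAlt 𝔤 k)

/-- The cycles `Z_k(𝔤) = ker ∂_k`, where `∂₀ = 0`. -/
def cycles : (k : ℕ) → Submodule ℝ (⋀[ℝ]^k 𝔤)
  | 0 => ⊤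
  | k + 1 => LinearMap.ker (boundary 𝔤 k)

/-- The boundaries `B_k(𝔤) = im ∂_{k+1}`. -/
def boundaries (k : ℕ) : Submodule ℝ (⋀[ℝ]^k 𝔤) :=
  LinearMap.range (boundary 𝔤 k)

/-- The Lie algebra homology `H_k(𝔤) = Z_k(𝔤) / B_k(𝔤)`. -/
abbrev LieHomology (k : ℕ) : Type _ :=
  Subquotient (cycles 𝔤 k) (boundaries 𝔤 k)

end LieHomology

/-! ### Contraction of a multivector with an alternating form -/

section Contraction

variable {V : Type*} [AddCommGroup V] [Module ℝ V] [TopologicalSpace V]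

theorem append_update_left {X : Type*} {m q : ℕ} [DecidableEq (Fin m)] (y : Fin m → X)
    (w : Fin q → X) (i : Fin m) (a : X) :
    Fin.append (Function.update y i a) w = Function.update (Fin.append y w) (Fin.castAdd q i) a := by
  ext l
  refine Fin.addCases (fun l => ?_) (fun l => ?_) l
  · by_cases h : l = i
    · subst h; simp
    · simp [Function.update_of_ne h, Function.update_of_ne (a := Fin.castAdd q l)
        (a' := Fin.castAdd q i) (by simpa using h)]
  · have : Fin.natAdd m l ≠ Fin.castAdd q i := by
      intro h; have := congrArg Fin.val h; simp at this; omega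
    simp [Function.update_of_ne this]

theorem append_update_right {X : Type*} {m q : ℕ} [DecidableEq (Fin q)] (y : Fin m → X)
    (w : Fin q → X) (i : Fin q) (a : X) :
    Fin.append y (Function.update w i a) = Function.update (Fin.append y w) (Fin.natAdd m i) a := by
  ext l
  refine Fin.addCases (fun l => ?_) (fun l => ?_) l
  · have : Fin.castAdd q l ≠ Fin.natAdd m i := by
      intro h; have := congrArg Fin.val h; simp at this; omega
    simp [Function.update_of_ne this]
  · by_cases h : l = i
    · subst h; simp
    · simp [Function.update_of_ne h, Function.update_of_ne (a := Fin.natAdd m l)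
        (a' := Fin.natAdd m i) (by simpa using h)]

/-- `(y₁, …, y_m) ↦ ι_{y_m} ⋯ ι_{y₁} α = α(y₁, …, y_m, ·, …, ·)`. -/
def contractAlt {m q : ℕ} (α : V [⋀^Fin (m + q)]→L[ℝ] ℝ) :
    V [⋀^Fin m]→ₗ[ℝ] (V [⋀^Fin q]→L[ℝ] ℝ) where
  toFun y :=
    { toFun := fun w => α (Fin.append y w)
      map_update_add' := by
        intro _ w i a b
        simp only [append_update_right]
        exact α.map_update_add _ _ _ _
      map_update_smul' := by
        intro _ w i c a
        simp only [append_update_right]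
        exact α.map_update_smul _ _ _ _
      map_eq_zero_of_eq' := by
        intro w i j hw hij
        refine α.map_eq_zero_of_eq _ (i := Fin.natAdd m i) (j := Fin.natAdd m j) ?_ ?_
        · simpa using hw
        · simpa using hij
      cont := by
        refine α.cont.comp (continuous_pi fun l => ?_)
        refine Fin.addCases (fun l => ?_) (fun l => ?_) l
        · simpa using continuous_const
        · simpa using continuous_apply l }
  map_update_add' := by
    intro _ y i a b
    ext w
    change α _ = α _ + α _
    simp only [append_update_left]
    exact α.map_update_add _ _ _ _
  map_update_smul' := by
    intro _ y i c a
    ext w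
    change α _ = c • α _
    simp only [append_update_left]
    exact α.map_update_smul _ _ _ _
  map_eq_zero_of_eq' := by
    intro y i j hy hij
    ext w
    refine α.map_eq_zero_of_eq _ (i := Fin.castAdd q i) (j := Fin.castAdd q j) ?_ ?_
    · simpa using hy
    · simpa using hij

/-- The contraction `ι_Y α` with `Y ∈ Λ^m V`, extended linearly from
`ι(y₁ ∧ ⋯ ∧ y_m) = ι_{y_m} ⋯ ι_{y₁}`. -/
def contract {m q : ℕ} (Y : ⋀[ℝ]^m V) (α : V [⋀^Fin (m + q)]→L[ℝ] ℝ) : V [⋀^Fin q]→L[ℝ] ℝ :=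
  exteriorPower.alternatingMapLinearEquiv (contractAlt α) Y

end Contraction

/-! ### Differential forms on a manifold -/

section Forms

variable (E : Type*) [NormedAddCommGroup E] [NormedSpace ℝ E]
  (M : Type*) [TopologicalSpace M] [ChartedSpace E M]

/-- A (not necessarily smooth) differential form of degree `q` on `M`. -/
abbrev RawForm (q : ℕ) : Type _ :=
  (x : M) → (TangentSpace 𝓘(ℝ, E) x) [⋀^Fin q]→L[ℝ] ℝ

/-- A (not necessarily smooth) inhomogeneous differential form on `M`: the family of its
homogeneous components. -/
abbrev TotalForm : Type _ := (q : ℕ) → RawForm E M q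

variable {E M}

/-- The expression of a form in the preferred chart at `x₀`: the pull-back of the form by the
inverse of that chart. It is meaningful on the target of the chart. -/
def chartRep {q : ℕ} (α : RawForm E M q) (x₀ : M) (y : E) : E [⋀^Fin q]→L[ℝ] ℝ :=
  (α ((extChartAt 𝓘(ℝ, E) x₀).symm y)).compContinuousLinearMap
    (mfderiv 𝓘(ℝ, E) 𝓘(ℝ, E) (extChartAt 𝓘(ℝ, E) x₀).symm y)

/-- Smoothness of a form: smoothness of its expressions in charts. -/
def IsSmoothForm {q : ℕ} (α : RawForm E M q) : Prop :=
  ∀ x₀ : M, ContDiffOn ℝ ∞ (chartRep α x₀) (extChartAt 𝓘(ℝ, E) x₀).target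

/-- The exterior derivative of a `q`-form, computed at `x` in the preferred chart at `x`. -/
def rawExtDeriv {q : ℕ} (α : RawForm E M q) : RawForm E M (q + 1) := fun x =>
  (extDeriv (chartRep α x) (extChartAt 𝓘(ℝ, E) x x)).compContinuousLinearMap
    (mfderiv 𝓘(ℝ, E) 𝓘(ℝ, E) (extChartAt 𝓘(ℝ, E) x) x)

/-- The exterior derivative `d` of an inhomogeneous form. -/
def dForm (α : TotalForm E M) : TotalForm E M
  | 0 => 0
  | q + 1 => rawExtDeriv (α q)

theorem chartRep_add {q : ℕ} (α β : RawForm E M q) (x₀ : M) :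
    chartRep (α + β) x₀ = chartRep α x₀ + chartRep β x₀ := rfl

theorem chartRep_smul {q : ℕ} (c : ℝ) (α : RawForm E M q) (x₀ : M) :
    chartRep (c • α) x₀ = c • chartRep α x₀ := rfl

theorem IsSmoothForm.differentiableAt {q : ℕ} {α : RawForm E M q} (h : IsSmoothForm α) (x : M) :
    DifferentiableAt ℝ (chartRep α x) (extChartAt 𝓘(ℝ, E) x x) :=
  ((h x).contDiffAt ((isOpen_extChartAt_target x).mem_nhds (mem_extChartAt_target x))
    ).differentiableAt (by simp)

theorem rawExtDeriv_add {q : ℕ} {α β : RawForm E M q} (hα : IsSmoothForm α)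
    (hβ : IsSmoothForm β) : rawExtDeriv (α + β) = rawExtDeriv α + rawExtDeriv β := by
  funext x
  simp only [rawExtDeriv, Pi.add_apply, chartRep_add]
  rw [extDeriv_add (hα.differentiableAt x) (hβ.differentiableAt x)]
  rfl

theorem rawExtDeriv_smul {q : ℕ} (c : ℝ) (α : RawForm E M q) :
    rawExtDeriv (c • α) = c • rawExtDeriv α := by
  funext x
  simp only [rawExtDeriv, Pi.smul_apply, chartRep_smul]
  rw [extDeriv_smul]
  rfl

theorem dForm_add {α β : TotalForm E M} (hα : ∀ q, IsSmoothForm (α q))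
    (hβ : ∀ q, IsSmoothForm (β q)) : dForm (α + β) = dForm α + dForm β := by
  funext q
  cases q with
  | zero => exact (add_zero (0 : RawForm E M 0)).symm
  | succ q => exact rawExtDeriv_add (hα q) (hβ q)

theorem dForm_smul (c : ℝ) (α : TotalForm E M) : dForm (c • α) = c • dForm α := by
  funext q
  cases q with
  | zero => exact (smul_zero c (A := RawForm E M 0)).symm
  | succ q => exact rawExtDeriv_smul c (α q)

theorem dForm_zero : dForm (0 : TotalForm E M) = 0 := by
  simpa using dForm_smul 0 (0 : TotalForm E M)

variable (E M) in
/-- The space `Ω^j(M)` of smooth differential forms of degree `j ∈ ℤ`, as the subspace of those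
inhomogeneous forms that are smooth and concentrated in degree `j`. It is zero for `j < 0`. -/
def Omega (j : ℤ) : Submodule ℝ (TotalForm E M) where
  carrier := {α | (∀ q, IsSmoothForm (α q)) ∧ ∀ q : ℕ, (q : ℤ) ≠ j → α q = 0}
  add_mem' := by
    rintro α β ⟨h1, h2⟩ ⟨h3, h4⟩
    refine ⟨fun q x₀ => ?_, fun q hq => ?_⟩
    · exact (h1 q x₀).add (h3 q x₀)
    · rw [Pi.add_apply, h2 q hq, h4 q hq, add_zero]
  zero_mem' := ⟨fun _ _ => contDiffOn_const (c := 0), fun _ _ => rfl⟩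
  smul_mem' := by
    rintro c α ⟨h1, h2⟩
    refine ⟨fun q x₀ => ?_, fun q hq => ?_⟩
    · exact (h1 q x₀).const_smul c
    · rw [Pi.smul_apply, h2 q hq, smul_zero]

variable (E M) in
/-- The closed forms of degree `j`. -/
def closedForms (j : ℤ) : Submodule ℝ (TotalForm E M) where
  carrier := {α | α ∈ Omega E M j ∧ dForm α = 0}
  add_mem' := by
    rintro α β ⟨h1, h2⟩ ⟨h3, h4⟩
    exact ⟨add_mem h1 h3, by rw [dForm_add h1.1 h3.1, h2, h4, add_zero]⟩
  zero_mem' := ⟨zero_mem _, dForm_zero⟩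
  smul_mem' := by
    rintro c α ⟨h1, h2⟩
    exact ⟨Submodule.smul_mem _ c h1, by rw [dForm_smul, h2, smul_zero]⟩

variable (E M) in
/-- The exact forms of degree `j`. -/
def exactForms (j : ℤ) : Submodule ℝ (TotalForm E M) where
  carrier := {α | ∃ β ∈ Omega E M (j - 1), dForm β = α}
  add_mem' := by
    rintro _ _ ⟨α, h1, rfl⟩ ⟨β, h3, rfl⟩
    exact ⟨α + β, add_mem h1 h3, dForm_add h1.1 h3.1⟩
  zero_mem' := ⟨0, zero_mem _, dForm_zero⟩
  smul_mem' := by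
    rintro c _ ⟨α, h1, rfl⟩
    exact ⟨c • α, Submodule.smul_mem _ c h1, dForm_smul c α⟩

variable (E M) in
/-- The de Rham cohomology `H^j_dR(M)`, `j ∈ ℤ`. -/
abbrev DeRham (j : ℤ) : Type _ :=
  Subquotient (closedForms E M j) (exactForms E M j)

/-! ### Multivector fields, contractions and Lie derivatives -/

variable (E M) in
/-- The smooth vector fields on `M`. -/
abbrev VectorFields [IsManifold 𝓘(ℝ, E) ∞ M] : Type _ :=
  Cₛ^∞⟮𝓘(ℝ, E); E, (TangentSpace 𝓘(ℝ, E) : M → Type _)⟯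

variable (E M) in
/-- The (not necessarily smooth) `m`-vector fields on `M`. -/
abbrev MultivectorField (m : ℕ) : Type _ := (x : M) → ⋀[ℝ]^m (TangentSpace 𝓘(ℝ, E) x)

/-- A vector field as a `1`-vector field. -/
def toMultivector (X : (x : M) → TangentSpace 𝓘(ℝ, E) x) : MultivectorField E M 1 := fun x =>
  exteriorPower.ιMulti ℝ 1 ![X x]

/-- The contraction `ι_Y α` of a differential form with an `m`-vector field. -/
def iota {m : ℕ} (Y : MultivectorField E M m) (α : TotalForm E M) : TotalForm E M := fun q x =>
  contract (Y x) (α (m + q) x)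

/-- The Lie derivative `𝓛_Y α = d ι_Y α - (-1)^m ι_Y dα` along an `m`-vector field. For `m = 1`
this is Cartan's formula for the usual Lie derivative. -/
def lieDer {m : ℕ} (Y : MultivectorField E M m) (α : TotalForm E M) : TotalForm E M :=
  dForm (iota Y α) - (-1 : ℝ) ^ m • iota Y (dForm α)

end Forms

/-! ### Pre-`n`-plectic manifolds, actions and co-momentum maps -/

section Plectic

variable {E : Type*} [NormedAddCommGroup E] [NormedSpace ℝ E]
  {M : Type*} [TopologicalSpace M] [ChartedSpace E M] [IsManifold 𝓘(ℝ, E) ∞ M]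
  {𝔤 : Type*} [LieRing 𝔤] [LieAlgebra ℝ 𝔤]

/-- `(M, ω₀)` is a pre-`n`-plectic manifold: `ω₀` is a closed `(n+1)`-form. -/
def IsPrePlectic (n : ℕ) (ω₀ : TotalForm E M) : Prop := ω₀ ∈ closedForms E M (n + 1)

/-- `X` is a Hamiltonian vector field for the form `α`: `dα = -ι_X ω₀`. -/
def IsHamiltonianVectorField (ω₀ α : TotalForm E M) (X : VectorFields E M) : Prop :=
  dForm α = -iota (toMultivector X) ω₀

/-- `α` is a Hamiltonian `(n-1)`-form. -/
def IsHamiltonianForm (n : ℕ) (ω₀ α : TotalForm E M) : Prop :=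
  α ∈ Omega E M (n - 1) ∧ ∃ X : VectorFields E M, IsHamiltonianVectorField ω₀ α X

variable (E M 𝔤) in
/-- An infinitesimal action of `𝔤` on `M`: a homomorphism of Lie algebras from `𝔤` to the smooth
vector fields on `M`. -/
structure InfinitesimalAction where
  /-- The vector field `v_a` of `a ∈ 𝔤`. -/
  field : 𝔤 →ₗ[ℝ] VectorFields E M
  map_lie : ∀ (a b : 𝔤) (x : M),
    field ⁅a, b⁆ x = VectorField.mlieBracket 𝓘(ℝ, E) (field a) (field b) x

namespace InfinitesimalAction

/-- The linear map `𝔤 → T_x M`, `a ↦ v_a(x)`. -/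
def at' (v : InfinitesimalAction E M 𝔤) (x : M) : 𝔤 →ₗ[ℝ] TangentSpace 𝓘(ℝ, E) x where
  toFun a := v.field a x
  map_add' a b := by rw [map_add]; rfl
  map_smul' c a := by rw [map_smul]; rfl

/-- The multivector field `v_p`, `p ∈ Λ^k 𝔤`, with `v_p = v_{a₁} ∧ ⋯ ∧ v_{a_k}` for
`p = a₁ ∧ ⋯ ∧ a_k`. -/
def multi (v : InfinitesimalAction E M 𝔤) {k : ℕ} (p : ⋀[ℝ]^k 𝔤) : MultivectorField E M k :=
  fun x => exteriorPower.map k (v.at' x) p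

/-- The action is multisymplectic: `𝓛_{v_a} ω₀ = 0` for all `a ∈ 𝔤`. -/
def IsMultisymplectic (v : InfinitesimalAction E M 𝔤) (ω₀ : TotalForm E M) : Prop :=
  ∀ a : 𝔤, lieDer (toMultivector (v.field a)) ω₀ = 0

/-- The action is locally `H`-preserving: `𝓛_{v_a} H` is closed for all `a ∈ 𝔤`. -/
def IsLocallyPreserving (v : InfinitesimalAction E M 𝔤) (H : TotalForm E M) : Prop :=
  ∀ a : 𝔤, dForm (lieDer (toMultivector (v.field a)) H) = 0

end InfinitesimalAction

/-- The sign `ς(k) = -(-1)^{k(k+1)/2}`. -/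
def sgn (k : ℕ) : ℝ := -(-1) ^ (k * (k + 1) / 2)

/-- The components `f_i : Λ^i 𝔤 → Ω^{n-i}(M)` form an `L_∞`-morphism from `𝔤` to the Lie
`n`-algebra of observables of `(M, ω₀)`. Only the components with `1 ≤ i ≤ n` carry information:
`f₀ = 0` is imposed, and `f_i = 0` for `i > n` since there are no forms of negative degree. -/
structure IsLInftyMorphism (n : ℕ) (ω₀ : TotalForm E M) (v : InfinitesimalAction E M 𝔤)
    (f : (i : ℕ) → (⋀[ℝ]^i 𝔤) →ₗ[ℝ] Omega E M ((n : ℤ) - i)) : Prop where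
  f_zero : f 0 = 0
  isHamiltonianForm : ∀ p : ⋀[ℝ]^1 𝔤, IsHamiltonianForm n ω₀ (f 1 p : TotalForm E M)
  /-- `-f_{k-1}(∂ p) = d f_k(p) + ς(k) ι(v_p) ω₀` for `k = j + 1 ∈ {1, …, n + 1}`. -/
  main : ∀ j ≤ n, ∀ p : ⋀[ℝ]^(j + 1) 𝔤,
    -(f j (boundary 𝔤 j p) : TotalForm E M) =
      dForm (f (j + 1) p : TotalForm E M) + sgn (j + 1) • iota (v.multi p) ω₀

/-- `f` is a (homotopy) co-momentum map for the action `v` on `(M, ω₀)`. -/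
structure IsComomentum (n : ℕ) (ω₀ : TotalForm E M) (v : InfinitesimalAction E M 𝔤)
    (f : (i : ℕ) → (⋀[ℝ]^i 𝔤) →ₗ[ℝ] Omega E M ((n : ℤ) - i)) : Prop
    extends IsLInftyMorphism n ω₀ v f where
  /-- `d(f₁(a)) = -ι_{v_a} ω₀`. -/
  moment : ∀ a : 𝔤, IsHamiltonianVectorField ω₀
    (f 1 (exteriorPower.ιMulti ℝ 1 ![a]) : TotalForm E M) (v.field a)

end Plectic

end MultiSymp

end

/-! Everything rests on the extended Cartan formula. If `β` is closed and `d ι_{v_a} β = 0` for all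
`a` (that is, `𝓛_{v_a} β = 0`), then `d ι(v_p) β = (-1)^k ι(v_{∂p}) β` for `p ∈ Λ^k 𝔤`
(`dForm_iotaMulti`). It applies to `β = dH`: since `d² = 0`, closedness of `𝓛_{v_a} H` says exactly
that `d ι_{v_a} dH = 0`.

Part 1. For a cycle `p` the formula makes `ι(v_p) dH` closed, hence also `𝓛_{v_p} H = d ι(v_p) H -
(-1)^k ι(v_p) dH`. For `p = ∂r` it makes `ι(v_p) dH` exact, and `𝓛_{v_p} H = d(ι(v_p) H + ι(v_r)
dH)`.

Part 2. On a cycle, `d f_k(p) = -ς(k) ι(v_p) ω`. Commuting `ι_{v_H}` past `ι(v_p)` and using `dH =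
-ι_{v_H} ω` gives `𝓛_{v_H} f_k(p) = d ι_{v_H} f_k(p) + ς(k) (-1)^k ι(v_p) dH`. As `ς(k)² = 1`, the
forms `𝓛_{v_p} H` and `-ς(k) 𝓛_{v_H} f_k(p)` differ by `d(ι(v_p) H + ς(k) ι_{v_H} f_k(p))`.

The extended formula follows by induction on the length of `p` from `𝓛_X ι_Y - ι_Y 𝓛_X = ι_{[X,Y]}`
(`lieDer_iota`). That identity is checked in a chart, which requires `d` to be independent of the
chart (`chartRep_rawExtDeriv`). -/

noncomputable section

namespace MultiSymp

/-! ### Cartan calculus on a normed space -/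

section LocalCalculus

variable {𝕜 E F : Type*} [NontriviallyNormedField 𝕜] [NormedAddCommGroup E] [NormedSpace 𝕜 E]
  [NormedAddCommGroup F] [NormedSpace 𝕜 F]

theorem removeNth_succ_vecCons {α : Type*} {n : ℕ} (i : Fin (n + 1)) (a : α)
    (w : Fin (n + 1) → α) :
    i.succ.removeNth (Matrix.vecCons a w) = Matrix.vecCons a (i.removeNth w) := by
  funext j
  refine Fin.cases ?_ (fun j => ?_) j <;> simp [Fin.removeNth]

theorem alternatingMap_vecCons_swap {R V W : Type*} [Ring R] [AddCommGroup V] [Module R V]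
    [AddCommGroup W] [Module R W] {q : ℕ} (f : V [⋀^Fin (q + 2)]→ₗ[R] W) (a b : V)
    (w : Fin q → V) :
    f (Matrix.vecCons a (Matrix.vecCons b w)) = -f (Matrix.vecCons b (Matrix.vecCons a w)) := by
  rw [← f.map_swap (Matrix.vecCons b (Matrix.vecCons a w)) (i := 0) (j := 1) (by simp)]
  congr 1
  funext j
  refine Fin.cases ?_ (fun j => Fin.cases ?_ (fun j => ?_) j) j
  · simp
  · simp
  · have h0 : j.succ.succ ≠ 0 := Fin.succ_ne_zero _
    have h1 : j.succ.succ ≠ 1 := by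
      intro h; have := congrArg Fin.val h; simp at this
    simp [Equiv.swap_apply_of_ne_of_ne h0 h1]

theorem vecCons_swap_apply {R V W : Type*} [Ring R] [AddCommGroup V] [Module R V]
    [TopologicalSpace V] [AddCommGroup W] [Module R W] [TopologicalSpace W] {q : ℕ}
    (f : V [⋀^Fin (q + 2)]→L[R] W) (a b : V) (w : Fin q → V) :
    f (Matrix.vecCons a (Matrix.vecCons b w)) = -f (Matrix.vecCons b (Matrix.vecCons a w)) :=
  alternatingMap_vecCons_swap f.toAlternatingMap a b w

variable (𝕜 E F) in
/-- `ContinuousAlternatingMap.curryLeft` as a continuous linear map. -/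
def curryLeftCLM (q : ℕ) : (E [⋀^Fin (q + 1)]→L[𝕜] F) →L[𝕜] (E →L[𝕜] E [⋀^Fin q]→L[𝕜] F) :=
  ContinuousAlternatingMap.curryLeftLI.toContinuousLinearMap

theorem hasFDerivAt_curryLeft {q : ℕ} {θ : E → E [⋀^Fin (q + 1)]→L[𝕜] F} {y : E}
    (hθ : DifferentiableAt 𝕜 θ y) :
    HasFDerivAt (fun z => (θ z).curryLeft) (curryLeftCLM 𝕜 E F q ∘L fderiv 𝕜 θ y) y := by
  exact (curryLeftCLM 𝕜 E F q).hasFDerivAt.comp (G := E →L[𝕜] E [⋀^Fin q]→L[𝕜] F) y hθ.hasFDerivAt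

theorem differentiableAt_curryLeft_apply {q : ℕ} {θ : E → E [⋀^Fin (q + 1)]→L[𝕜] F} {X : E → E}
    {y : E} (hθ : DifferentiableAt 𝕜 θ y) (hX : DifferentiableAt 𝕜 X y) :
    DifferentiableAt 𝕜 (fun z => (θ z).curryLeft (X z)) y :=
  ((hasFDerivAt_curryLeft hθ).clm_apply hX.hasFDerivAt).differentiableAt

/-- Leibniz rule for the bilinear pairing of a form with a vector field. -/
theorem fderiv_curryLeft_apply {q : ℕ} {θ : E → E [⋀^Fin (q + 1)]→L[𝕜] F} {X : E → E} {y : E}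
    (hθ : DifferentiableAt 𝕜 θ y) (hX : DifferentiableAt 𝕜 X y) (u : E) (w : Fin q → E) :
    fderiv 𝕜 (fun z => (θ z).curryLeft (X z)) y u w =
      fderiv 𝕜 θ y u (Matrix.vecCons (X y) w) + θ y (Matrix.vecCons (fderiv 𝕜 X y u) w) := by
  rw [((hasFDerivAt_curryLeft hθ).clm_apply hX.hasFDerivAt).fderiv, add_comm]
  rfl

theorem apply_vecCons_lieBracket {q : ℕ} (f : E [⋀^Fin (q + 1)]→L[𝕜] F) (X Y : E → E) (y : E)
    (w : Fin q → E) :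
    f (Matrix.vecCons (VectorField.lieBracket 𝕜 X Y y) w) =
      f (Matrix.vecCons (fderiv 𝕜 Y y (X y)) w) - f (Matrix.vecCons (fderiv 𝕜 X y (Y y)) w) := by
  change f.curryLeft (fderiv 𝕜 Y y (X y) - fderiv 𝕜 X y (Y y)) w = _
  rw [map_sub]
  rfl

/-- Cartan's formula for the Lie derivative of a differential form on a normed space. -/
theorem extDeriv_curryLeft_add_apply {q : ℕ} {θ : E → E [⋀^Fin (q + 1)]→L[𝕜] F} {X : E → E} {y : E}
    (hθ : DifferentiableAt 𝕜 θ y) (hX : DifferentiableAt 𝕜 X y) (w : Fin (q + 1) → E) :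
    extDeriv (fun z => (θ z).curryLeft (X z)) y w + extDeriv θ y (Matrix.vecCons (X y) w) =
      fderiv 𝕜 θ y (X y) w +
        ∑ i : Fin (q + 1), (-1) ^ (i : ℕ) •
          θ y (Matrix.vecCons (fderiv 𝕜 X y (w i)) (i.removeNth w)) := by
  simp only [extDeriv, ContinuousAlternatingMap.alternatizeUncurryFin_apply,
    fderiv_curryLeft_apply hθ hX]
  rw [Fin.sum_univ_succ (n := q + 1)]
  simp only [removeNth_succ_vecCons, smul_add, Finset.sum_add_distrib]
  simp [pow_succ, Fin.tail_def]
  abel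

theorem extDeriv_zero_form_vecCons {θ : E → E [⋀^Fin 0]→L[𝕜] F} {y a : E} (w : Fin 0 → E) :
    extDeriv θ y (Matrix.vecCons a w) = fderiv 𝕜 θ y a w := by
  simp only [extDeriv, ContinuousAlternatingMap.alternatizeUncurryFin_apply]
  simp

/-- The commutator of a Lie derivative and a contraction, in degree zero. -/
theorem extDeriv_commutator_zero {θ : E → E [⋀^Fin 1]→L[𝕜] F} {X Y : E → E} {y : E}
    (hθ : DifferentiableAt 𝕜 θ y) (hX : DifferentiableAt 𝕜 X y) (hY : DifferentiableAt 𝕜 Y y)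
    (w : Fin 0 → E) :
    extDeriv (fun z => (θ z).curryLeft (Y z)) y (Matrix.vecCons (X y) w) -
      (extDeriv (fun z => (θ z).curryLeft (X z)) y (Matrix.vecCons (Y y) w) +
        extDeriv θ y (Matrix.vecCons (X y) (Matrix.vecCons (Y y) w))) =
      θ y (Matrix.vecCons (VectorField.lieBracket 𝕜 X Y y) w) := by
  rw [extDeriv_curryLeft_add_apply hθ hX, extDeriv_zero_form_vecCons,
    fderiv_curryLeft_apply hθ hY, apply_vecCons_lieBracket]
  simp

/-- The commutator of a Lie derivative and a contraction, in positive degree. -/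
theorem extDeriv_commutator_succ {q : ℕ} {θ : E → E [⋀^Fin (q + 2)]→L[𝕜] F} {X Y : E → E} {y : E}
    (hθ : DifferentiableAt 𝕜 θ y) (hX : DifferentiableAt 𝕜 X y) (hY : DifferentiableAt 𝕜 Y y)
    (w : Fin (q + 1) → E) :
    extDeriv (fun z => ((θ z).curryLeft (Y z)).curryLeft (X z)) y w +
      extDeriv (fun z => (θ z).curryLeft (Y z)) y (Matrix.vecCons (X y) w) -
      (extDeriv (fun z => (θ z).curryLeft (X z)) y (Matrix.vecCons (Y y) w) +
        extDeriv θ y (Matrix.vecCons (X y) (Matrix.vecCons (Y y) w))) =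
      θ y (Matrix.vecCons (VectorField.lieBracket 𝕜 X Y y) w) := by
  rw [extDeriv_curryLeft_add_apply hθ hX,
    extDeriv_curryLeft_add_apply (differentiableAt_curryLeft_apply hθ hY) hX,
    fderiv_curryLeft_apply hθ hY, apply_vecCons_lieBracket,
    Fin.sum_univ_succ (n := q + 1)]
  simp only [removeNth_succ_vecCons, ContinuousAlternatingMap.curryLeft_apply_apply,
    Matrix.cons_val_succ, Matrix.cons_val_zero, Fin.val_succ, pow_succ]
  -- The derivatives of `θ` and all terms with `DX (w i)` cancel once `Y` and `DX (w i)` are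
  -- interchanged in the first two slots. What survives is `DY(X) - DX(Y)` in the first slot, the
  -- bracket.
  simp only [vecCons_swap_apply (θ y) (fderiv 𝕜 X y _) (Y y)]
  simp [Fin.tail_def]
  abel

end LocalCalculus

/-! ### Forms, vector fields and the exterior derivative in charts -/

section Charts

variable {E : Type*} [NormedAddCommGroup E] [NormedSpace ℝ E]
  {M : Type*} [TopologicalSpace M] [ChartedSpace E M]

/-- The derivative of the inverse of the preferred chart at `x₀`, the tangent spaces of `M` being
identified with `E`. -/
def chartDiff (x₀ : M) (y : E) : E →L[ℝ] E :=
  mfderiv 𝓘(ℝ, E) 𝓘(ℝ, E) (extChartAt 𝓘(ℝ, E) x₀).symm y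

/-- The expression of a vector field in the preferred chart at `x₀`. -/
def chartField (X : (x : M) → TangentSpace 𝓘(ℝ, E) x) (x₀ : M) (y : E) : E :=
  VectorField.mpullback 𝓘(ℝ, E) 𝓘(ℝ, E) (extChartAt 𝓘(ℝ, E) x₀).symm X y

/-- Tangent spaces at different points are all copies of `E`, but the type of `α x` depends on `x`;
base point and linear map therefore have to be replaced together. -/
theorem compContinuousLinearMap_congr {q : ℕ} (α : RawForm E M q) {x x' : M} (hx : x = x')
    {L L' : E →L[ℝ] E} (hL : L = L') :
    ((α x).compContinuousLinearMap (L : E →L[ℝ] TangentSpace 𝓘(ℝ, E) x) : E [⋀^Fin q]→L[ℝ] ℝ) =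
      (α x').compContinuousLinearMap (L' : E →L[ℝ] TangentSpace 𝓘(ℝ, E) x') := by
  subst hx hL
  rfl

variable [IsManifold 𝓘(ℝ, E) ∞ M]

theorem contDiffOn_extDeriv {q : ℕ} {θ : E → E [⋀^Fin q]→L[ℝ] ℝ} {s : Set E} (hs : IsOpen s)
    (hθ : ContDiffOn ℝ ∞ θ s) : ContDiffOn ℝ ∞ (extDeriv θ) s :=
  (ContinuousAlternatingMap.alternatizeUncurryFinCLM ℝ E ℝ).contDiff.comp_contDiffOn
    (hθ.fderiv_of_isOpen hs (by simp))

theorem isInvertible_mfderiv_extChartAt_symm {x₀ : M} {y : E}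
    (hy : y ∈ (extChartAt 𝓘(ℝ, E) x₀).target) :
    (mfderiv 𝓘(ℝ, E) 𝓘(ℝ, E) (extChartAt 𝓘(ℝ, E) x₀).symm y).IsInvertible := by
  have h := isInvertible_mfderivWithin_extChartAt_symm (I := 𝓘(ℝ, E)) hy
  rwa [modelWithCornersSelf_coe, Set.range_id, mfderivWithin_univ] at h

theorem mdifferentiableAt_extChartAt_symm {x₀ : M} {y : E}
    (hy : y ∈ (extChartAt 𝓘(ℝ, E) x₀).target) :
    MDifferentiableAt 𝓘(ℝ, E) 𝓘(ℝ, E) (extChartAt 𝓘(ℝ, E) x₀).symm y :=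
  mdifferentiableAt_of_isInvertible_mfderiv (isInvertible_mfderiv_extChartAt_symm hy)

theorem chartDiff_self (x : M) : chartDiff x (extChartAt 𝓘(ℝ, E) x x) = .id ℝ E := by
  have h := mfderivWithin_range_extChartAt_symm (I := 𝓘(ℝ, E)) (x := x)
  rw [modelWithCornersSelf_coe, Set.range_id, mfderivWithin_univ] at h
  exact h

/-- `mpullback` uses `ContinuousLinearMap.inverse`, which has a junk value off the invertible maps;
on the chart target the derivative is invertible. -/
theorem chartDiff_chartField (X : (x : M) → TangentSpace 𝓘(ℝ, E) x) (x₀ : M) {y : E}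
    (hy : y ∈ (extChartAt 𝓘(ℝ, E) x₀).target) :
    chartDiff x₀ y (chartField X x₀ y) = X ((extChartAt 𝓘(ℝ, E) x₀).symm y) := by
  have key : ∀ (L : E →L[ℝ] E) (_ : L.IsInvertible) (u : E), L (L.inverse u) = u := by
    rintro _ ⟨e, rfl⟩ u
    simp
  exact key _ (isInvertible_mfderiv_extChartAt_symm hy) _

theorem chartField_self (X : (x : M) → TangentSpace 𝓘(ℝ, E) x) (x : M) :
    chartField X x (extChartAt 𝓘(ℝ, E) x x) = X x := by
  have h := chartDiff_chartField X x (mem_extChartAt_target x)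
  rw [chartDiff_self] at h
  refine Eq.trans h ?_
  rw [extChartAt_to_inv]

/-- The manifold bracket is by definition the chart bracket transported back by the inverse
derivative of the chart at `x`, and that derivative is the identity at `x` itself. -/
theorem mlieBracket_eq_lieBracket_chartField (X Y : (x : M) → TangentSpace 𝓘(ℝ, E) x) (x : M) :
    VectorField.mlieBracket 𝓘(ℝ, E) X Y x =
      VectorField.lieBracket ℝ (chartField X x) (chartField Y x) (extChartAt 𝓘(ℝ, E) x x) := by
  have key : ∀ (L : E →L[ℝ] E) (_ : L = .id ℝ E) (u : E), L.inverse u = u := by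
    rintro _ rfl u
    simp
  refine (key _ mfderiv_extChartAt_self _).trans ?_
  simp only [modelWithCornersSelf_coe, Set.range_id, Set.preimage_univ, Set.inter_self,
    VectorField.mpullbackWithin_univ]
  exact congrFun (VectorField.lieBracketWithin_univ (V := chartField X x) (W := chartField Y x)) _

theorem contDiffOn_chartField [CompleteSpace E] (X : VectorFields E M) (x₀ : M) :
    ContDiffOn ℝ ∞ (chartField X x₀) (extChartAt 𝓘(ℝ, E) x₀).target := by
  intro y hy
  have hsymm : ContMDiffAt 𝓘(ℝ, E) 𝓘(ℝ, E) ∞ (extChartAt 𝓘(ℝ, E) x₀).symm y :=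
    (contMDiffOn_extChartAt_symm x₀).contMDiffAt ((isOpen_extChartAt_target x₀).mem_nhds hy)
  have h := ContMDiffAt.mpullback_vectorField_preimage (m := ∞) (n := ∞)
    (X.contMDiff _) hsymm (isInvertible_mfderiv_extChartAt_symm hy) (by simp)
  exact (contMDiffAt_vectorSpace_iff_contDiffAt.1 h).contDiffWithinAt

theorem chartRep_self {q : ℕ} (α : RawForm E M q) (x : M) :
    chartRep α x (extChartAt 𝓘(ℝ, E) x x) = α x :=
  compContinuousLinearMap_congr α (extChartAt_to_inv x) (chartDiff_self x)

theorem rawExtDeriv_self {q : ℕ} (α : RawForm E M q) (x : M) :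
    rawExtDeriv α x = extDeriv (chartRep α x) (extChartAt 𝓘(ℝ, E) x x) := by
  have key : ∀ (f : E [⋀^Fin (q + 1)]→L[ℝ] ℝ) (L : E →L[ℝ] E) (_ : L = .id ℝ E),
      f.compContinuousLinearMap L = f := by
    rintro f _ rfl
    rfl
  exact key _ _ mfderiv_extChartAt_self

theorem contDiffAt_chart_change (x₀ x₁ : M) {y : E}
    (hy : y ∈ (extChartAt 𝓘(ℝ, E) x₀).target)
    (hy' : (extChartAt 𝓘(ℝ, E) x₀).symm y ∈ (extChartAt 𝓘(ℝ, E) x₁).source) :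
    ContDiffAt ℝ ∞ (extChartAt 𝓘(ℝ, E) x₁ ∘ (extChartAt 𝓘(ℝ, E) x₀).symm) y := by
  have hsymm : ContMDiffAt 𝓘(ℝ, E) 𝓘(ℝ, E) ∞ (extChartAt 𝓘(ℝ, E) x₀).symm y :=
    (contMDiffOn_extChartAt_symm x₀).contMDiffAt ((isOpen_extChartAt_target x₀).mem_nhds hy)
  rw [extChartAt_source] at hy'
  exact ((contMDiffAt_extChartAt' hy').comp y hsymm).contDiffAt

theorem eventually_mem_chart_overlap (x₀ x₁ : M) {y : E}
    (hy : y ∈ (extChartAt 𝓘(ℝ, E) x₀).target)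
    (hy' : (extChartAt 𝓘(ℝ, E) x₀).symm y ∈ (extChartAt 𝓘(ℝ, E) x₁).source) :
    ∀ᶠ z in 𝓝 y, z ∈ (extChartAt 𝓘(ℝ, E) x₀).target ∧
      (extChartAt 𝓘(ℝ, E) x₀).symm z ∈ (extChartAt 𝓘(ℝ, E) x₁).source :=
  Filter.inter_mem ((isOpen_extChartAt_target x₀).mem_nhds hy)
    ((mdifferentiableAt_extChartAt_symm hy).continuousAt
      ((isOpen_extChartAt_source x₁).mem_nhds hy'))

/-- Chain rule: on the overlap, the inverse chart at `x₀` is the inverse chart at `x₁` after the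
transition map. -/
theorem chartDiff_eq_comp (x₀ x₁ : M) {y : E}
    (hy : y ∈ (extChartAt 𝓘(ℝ, E) x₀).target)
    (hy' : (extChartAt 𝓘(ℝ, E) x₀).symm y ∈ (extChartAt 𝓘(ℝ, E) x₁).source) :
    chartDiff x₀ y = chartDiff x₁ (extChartAt 𝓘(ℝ, E) x₁ ((extChartAt 𝓘(ℝ, E) x₀).symm y)) ∘L
      fderiv ℝ (extChartAt 𝓘(ℝ, E) x₁ ∘ (extChartAt 𝓘(ℝ, E) x₀).symm) y := by
  have hT : MDifferentiableAt 𝓘(ℝ, E) 𝓘(ℝ, E)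
      (extChartAt 𝓘(ℝ, E) x₁ ∘ (extChartAt 𝓘(ℝ, E) x₀).symm) y :=
    ((contDiffAt_chart_change x₀ x₁ hy hy').differentiableAt (by simp)).mdifferentiableAt
  have hev : (extChartAt 𝓘(ℝ, E) x₀).symm =ᶠ[𝓝 y] (extChartAt 𝓘(ℝ, E) x₁).symm ∘
      (extChartAt 𝓘(ℝ, E) x₁ ∘ (extChartAt 𝓘(ℝ, E) x₀).symm) := by
    filter_upwards [eventually_mem_chart_overlap x₀ x₁ hy hy'] with z hz
    exact ((extChartAt 𝓘(ℝ, E) x₁).left_inv hz.2).symm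
  have h1 := hev.mfderiv_eq (I := 𝓘(ℝ, E)) (I' := 𝓘(ℝ, E))
  have h2 := mfderiv_comp y (mdifferentiableAt_extChartAt_symm
    ((extChartAt 𝓘(ℝ, E) x₁).map_source hy')) hT
  rw [mfderiv_eq_fderiv] at h2
  exact h1.trans h2

/-- Change of charts for the local expression of a form. -/
theorem chartRep_eq_pullback {q : ℕ} (α : RawForm E M q) (x₀ x₁ : M) {y : E}
    (hy : y ∈ (extChartAt 𝓘(ℝ, E) x₀).target)
    (hy' : (extChartAt 𝓘(ℝ, E) x₀).symm y ∈ (extChartAt 𝓘(ℝ, E) x₁).source) :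
    chartRep α x₀ y =
      (chartRep α x₁ ((extChartAt 𝓘(ℝ, E) x₁ ∘ (extChartAt 𝓘(ℝ, E) x₀).symm) y)
        ).compContinuousLinearMap
        (fderiv ℝ (extChartAt 𝓘(ℝ, E) x₁ ∘ (extChartAt 𝓘(ℝ, E) x₀).symm) y) :=
  compContinuousLinearMap_congr α ((extChartAt 𝓘(ℝ, E) x₁).left_inv hy').symm
    (chartDiff_eq_comp x₀ x₁ hy hy')

/-- The exterior derivative is computed in any chart. -/
theorem chartRep_rawExtDeriv {q : ℕ} {α : RawForm E M q} (hα : IsSmoothForm α) (x₀ : M) {y : E}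
    (hy : y ∈ (extChartAt 𝓘(ℝ, E) x₀).target) :
    chartRep (rawExtDeriv α) x₀ y = extDeriv (chartRep α x₀) y := by
  -- `rawExtDeriv` at a point uses the preferred chart of that very point. Naturality of `extDeriv`
  -- under the transition map carries the result to the chart at `x₀`.
  set x := (extChartAt 𝓘(ℝ, E) x₀).symm y with hx
  have hy' : (extChartAt 𝓘(ℝ, E) x₀).symm y ∈ (extChartAt 𝓘(ℝ, E) x).source :=
    mem_extChartAt_source x
  have hev : chartRep α x₀ =ᶠ[𝓝 y] fun z =>
      (chartRep α x ((extChartAt 𝓘(ℝ, E) x ∘ (extChartAt 𝓘(ℝ, E) x₀).symm) z)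
        ).compContinuousLinearMap
        (fderiv ℝ (extChartAt 𝓘(ℝ, E) x ∘ (extChartAt 𝓘(ℝ, E) x₀).symm) z) := by
    filter_upwards [eventually_mem_chart_overlap x₀ x hy hy'] with z hz
    exact chartRep_eq_pullback α x₀ x hz.1 hz.2
  have hd : DifferentiableAt ℝ (chartRep α x)
      ((extChartAt 𝓘(ℝ, E) x ∘ (extChartAt 𝓘(ℝ, E) x₀).symm) y) := hα.differentiableAt x
  rw [hev.extDeriv_eq, extDeriv_pullback hd (contDiffAt_chart_change x₀ x hy hy')
    (by rw [minSmoothness_of_isRCLikeNormedField]; exact WithTop.coe_le_coe.2 le_top),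
    chartRep_eq_pullback (rawExtDeriv α) x₀ x hy hy']
  congr 1
  exact (chartRep_self (rawExtDeriv α) x).trans (rawExtDeriv_self α x)

theorem IsSmoothForm.rawExtDeriv {q : ℕ} {α : RawForm E M q} (hα : IsSmoothForm α) :
    IsSmoothForm (rawExtDeriv α) := fun x₀ =>
  (contDiffOn_extDeriv (isOpen_extChartAt_target x₀) (hα x₀)).congr
    fun _ hy => chartRep_rawExtDeriv hα x₀ hy

theorem rawExtDeriv_rawExtDeriv {q : ℕ} {α : RawForm E M q} (hα : IsSmoothForm α) :
    rawExtDeriv (rawExtDeriv α) = 0 := by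
  funext x
  have hmem := (isOpen_extChartAt_target (I := 𝓘(ℝ, E)) x).mem_nhds (mem_extChartAt_target x)
  have h : chartRep (MultiSymp.rawExtDeriv α) x =ᶠ[𝓝 (extChartAt 𝓘(ℝ, E) x x)]
      extDeriv (chartRep α x) := by
    filter_upwards [hmem] with y hy using chartRep_rawExtDeriv hα x hy
  rw [MultiSymp.rawExtDeriv, h.extDeriv_eq, extDeriv_extDeriv_apply ((hα x).contDiffAt hmem)
    (by rw [minSmoothness_of_isRCLikeNormedField]; exact WithTop.coe_le_coe.2 le_top)]
  rfl

end Charts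

/-! ### Contractions of multivectors with alternating forms -/

section PointwiseContraction

variable {V : Type*} [AddCommGroup V] [Module ℝ V] [TopologicalSpace V]

theorem apply_comp_finCast (β : (q : ℕ) → V [⋀^Fin q]→L[ℝ] ℝ) {a b : ℕ} (h : a = b)
    (u : Fin b → V) : β a (u ∘ Fin.cast h) = β b u := by
  subst h
  rfl

theorem contract_ιMulti_apply {m q : ℕ} (y : Fin m → V) (α : V [⋀^Fin (m + q)]→L[ℝ] ℝ)
    (w : Fin q → V) : contract (exteriorPower.ιMulti ℝ m y) α w = α (Fin.append y w) := by
  rw [contract, exteriorPower.alternatingMapLinearEquiv_apply_ιMulti]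
  rfl

theorem contract_add_left {m q : ℕ} (Y Z : ⋀[ℝ]^m V) (α : V [⋀^Fin (m + q)]→L[ℝ] ℝ) :
    contract (Y + Z) α = contract Y α + contract Z α :=
  map_add _ _ _

theorem contract_smul_left {m q : ℕ} (c : ℝ) (Y : ⋀[ℝ]^m V) (α : V [⋀^Fin (m + q)]→L[ℝ] ℝ) :
    contract (c • Y) α = c • contract Y α :=
  map_smul _ _ _

theorem contract_add_right {m q : ℕ} (Y : ⋀[ℝ]^m V) (α β : V [⋀^Fin (m + q)]→L[ℝ] ℝ) :
    contract Y (α + β) = contract Y α + contract Y β := by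
  have h : contractAlt (α + β) = contractAlt α + contractAlt β := rfl
  rw [contract, h, map_add]
  rfl

theorem contract_smul_right {m q : ℕ} (c : ℝ) (Y : ⋀[ℝ]^m V) (α : V [⋀^Fin (m + q)]→L[ℝ] ℝ) :
    contract Y (c • α) = c • contract Y α := by
  have h : contractAlt (c • α) = c • contractAlt α := rfl
  rw [contract, h, map_smul]
  rfl

/-- Induction on the elements of an exterior power. -/
theorem exteriorPower_induction {W : Type*} [AddCommGroup W] [Module ℝ W] {m : ℕ}
    {P : ⋀[ℝ]^m W → Prop} (hι : ∀ y, P (exteriorPower.ιMulti ℝ m y))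
    (hadd : ∀ Y Z, P Y → P Z → P (Y + Z)) (hsmul : ∀ (c : ℝ) Y, P Y → P (c • Y))
    (Y : ⋀[ℝ]^m W) : P Y := by
  have hY : Y ∈ Submodule.span ℝ (Set.range (exteriorPower.ιMulti ℝ m (M := W))) := by
    rw [exteriorPower.ιMulti_span]
    trivial
  induction hY using Submodule.span_induction with
  | mem Y h => obtain ⟨y, rfl⟩ := h; exact hι y
  | zero => simpa using hsmul 0 _ (hι 0)
  | add Y Z _ _ hY hZ => exact hadd Y Z hY hZ
  | smul c Y _ hY => exact hsmul c Y hY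

/-- Contraction of a family of alternating forms of all degrees. -/
def contractFamily {m : ℕ} (Y : ⋀[ℝ]^m V) (β : (q : ℕ) → V [⋀^Fin q]→L[ℝ] ℝ) :
    (q : ℕ) → V [⋀^Fin q]→L[ℝ] ℝ :=
  fun q => contract Y (β (m + q))

theorem contractFamily_singleton_apply (a : V) (β : (q : ℕ) → V [⋀^Fin q]→L[ℝ] ℝ) (q : ℕ)
    (w : Fin q → V) :
    contractFamily (exteriorPower.ιMulti ℝ 1 ![a]) β q w = β (q + 1) (Matrix.vecCons a w) := by
  rw [contractFamily, contract_ιMulti_apply, Fin.append_left_eq_cons, apply_comp_finCast]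
  rfl

/-- The two sides evaluate `β` in the degrees `m + 1 + q` and `m + q + 1`, which are equal only
propositionally. Treating all degrees as one family confines the transport to `apply_comp_finCast`.
-/
theorem contractFamily_vecCons {m : ℕ} (a : V) (y : Fin m → V)
    (β : (q : ℕ) → V [⋀^Fin q]→L[ℝ] ℝ) :
    contractFamily (exteriorPower.ιMulti ℝ (m + 1) (Matrix.vecCons a y)) β =
      contractFamily (exteriorPower.ιMulti ℝ m y)
        (contractFamily (exteriorPower.ιMulti ℝ 1 ![a]) β) := by
  funext q
  ext w
  conv_rhs => rw [contractFamily, contract_ιMulti_apply, contractFamily_singleton_apply]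
  rw [contractFamily, contract_ιMulti_apply, Matrix.vecCons, Fin.append_cons, apply_comp_finCast]
  rfl

theorem contractFamily_zero (y : Fin 0 → V) (β : (q : ℕ) → V [⋀^Fin q]→L[ℝ] ℝ) :
    contractFamily (exteriorPower.ιMulti ℝ 0 y) β = β := by
  funext q
  ext w
  rw [contractFamily, contract_ιMulti_apply, Fin.append_left_nil _ _ rfl, apply_comp_finCast]

theorem contractFamily_smul_right {m : ℕ} (c : ℝ) (Y : ⋀[ℝ]^m V)
    (β : (q : ℕ) → V [⋀^Fin q]→L[ℝ] ℝ) :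
    contractFamily Y (c • β) = c • contractFamily Y β :=
  funext fun _ => contract_smul_right _ _ _

theorem contractFamily_singleton_comm (a b : V) (β : (q : ℕ) → V [⋀^Fin q]→L[ℝ] ℝ) :
    contractFamily (exteriorPower.ιMulti ℝ 1 ![a])
        (contractFamily (exteriorPower.ιMulti ℝ 1 ![b]) β) =
      (-1 : ℝ) • contractFamily (exteriorPower.ιMulti ℝ 1 ![b])
        (contractFamily (exteriorPower.ιMulti ℝ 1 ![a]) β) := by
  funext q
  ext w
  have h := vecCons_swap_apply (β (q + 2)) b a w
  simp only [Pi.smul_apply, ContinuousAlternatingMap.smul_apply, contractFamily_singleton_apply, h]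
  simp

theorem contractFamily_singleton_comm_ιMulti {m : ℕ} (a : V) (y : Fin m → V)
    (β : (q : ℕ) → V [⋀^Fin q]→L[ℝ] ℝ) :
    contractFamily (exteriorPower.ιMulti ℝ 1 ![a])
        (contractFamily (exteriorPower.ιMulti ℝ m y) β) =
      (-1 : ℝ) ^ m • contractFamily (exteriorPower.ιMulti ℝ m y)
        (contractFamily (exteriorPower.ιMulti ℝ 1 ![a]) β) := by
  induction m generalizing β with
  | zero => simp [contractFamily_zero]
  | succ m ih =>
    obtain ⟨b, y, rfl⟩ : ∃ b z, y = Matrix.vecCons b z := ⟨y 0, Fin.tail y, by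
      rw [Matrix.vecCons, Fin.cons_self_tail]⟩
    rw [contractFamily_vecCons b y, contractFamily_vecCons b y, ih,
      contractFamily_singleton_comm a b,
      contractFamily_smul_right, smul_smul, pow_succ]

/-- Contractions with single vectors anticommute, so passing `m` of them costs `(-1)^m`; the general
case follows by linearity in `Y`. -/
theorem contractFamily_singleton_comm_multivector {m : ℕ} (a : V) (Y : ⋀[ℝ]^m V)
    (β : (q : ℕ) → V [⋀^Fin q]→L[ℝ] ℝ) :
    contractFamily (exteriorPower.ιMulti ℝ 1 ![a]) (contractFamily Y β) =
      (-1 : ℝ) ^ m • contractFamily Y (contractFamily (exteriorPower.ιMulti ℝ 1 ![a]) β) := by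
  induction Y using exteriorPower_induction with
  | hι y => exact contractFamily_singleton_comm_ιMulti a y β
  | hadd Y Z hY hZ =>
    have h (β : (q : ℕ) → V [⋀^Fin q]→L[ℝ] ℝ) :
        contractFamily (Y + Z) β = contractFamily Y β + contractFamily Z β :=
      funext fun _ => contract_add_left _ _ _
    have h' (β γ : (q : ℕ) → V [⋀^Fin q]→L[ℝ] ℝ) :
        contractFamily (exteriorPower.ιMulti ℝ 1 ![a]) (β + γ) =
          contractFamily (exteriorPower.ιMulti ℝ 1 ![a]) β +
            contractFamily (exteriorPower.ιMulti ℝ 1 ![a]) γ :=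
      funext fun _ => contract_add_right _ _ _
    rw [h, h, h', hY, hZ, smul_add]
  | hsmul c Y hY =>
    have h (β : (q : ℕ) → V [⋀^Fin q]→L[ℝ] ℝ) :
        contractFamily (c • Y) β = c • contractFamily Y β :=
      funext fun _ => contract_smul_left _ _ _
    rw [h, h, contractFamily_smul_right, hY, smul_comm]

end PointwiseContraction

/-! ### Contractions and Lie derivatives of forms on the manifold -/

section FormCalculus

variable {E : Type*} [NormedAddCommGroup E] [NormedSpace ℝ E]
  {M : Type*} [TopologicalSpace M] [ChartedSpace E M]

theorem iota_add {m : ℕ} (Y : MultivectorField E M m) (α β : TotalForm E M) :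
    iota Y (α + β) = iota Y α + iota Y β :=
  funext fun _ => funext fun _ => contract_add_right _ _ _

theorem iota_smul {m : ℕ} (c : ℝ) (Y : MultivectorField E M m) (α : TotalForm E M) :
    iota Y (c • α) = c • iota Y α :=
  funext fun _ => funext fun _ => contract_smul_right _ _ _

theorem iota_neg {m : ℕ} (Y : MultivectorField E M m) (α : TotalForm E M) :
    iota Y (-α) = -iota Y α := by
  have h : -α = (-1 : ℝ) • α := by module
  rw [h, iota_smul]
  module

theorem iota_zero {m : ℕ} (Y : MultivectorField E M m) :
    iota Y (0 : TotalForm E M) = 0 := by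
  simpa using iota_smul 0 Y (0 : TotalForm E M)

theorem iota_toMultivector_comm {m : ℕ} (X : (x : M) → TangentSpace 𝓘(ℝ, E) x)
    (Y : MultivectorField E M m) (α : TotalForm E M) :
    iota (toMultivector X) (iota Y α) = (-1 : ℝ) ^ m • iota Y (iota (toMultivector X) α) := by
  funext q x
  exact congrFun (contractFamily_singleton_comm_multivector (X x) (Y x) fun q => α q x) q

theorem iota_toMultivector_apply (X : (x : M) → TangentSpace 𝓘(ℝ, E) x) (α : TotalForm E M)
    (q : ℕ) (x : M) (w : Fin q → TangentSpace 𝓘(ℝ, E) x) :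
    iota (toMultivector X) α q x w = α (q + 1) x (Matrix.vecCons (X x) w) :=
  contractFamily_singleton_apply (X x) (fun q => α q x) q w

theorem lieDer_toMultivector (X : (x : M) → TangentSpace 𝓘(ℝ, E) x) (α : TotalForm E M) :
    lieDer (toMultivector X) α =
      dForm (iota (toMultivector X) α) + iota (toMultivector X) (dForm α) := by
  rw [lieDer]
  module

/-- Degree `0` stands apart because `dForm` vanishes there, so that only the term `ι_X dα` survives.
-/
theorem lieDer_toMultivector_apply_zero (X : (x : M) → TangentSpace 𝓘(ℝ, E) x)
    (α : TotalForm E M) (x : M) (w : Fin 0 → TangentSpace 𝓘(ℝ, E) x) :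
    lieDer (toMultivector X) α 0 x w = rawExtDeriv (α 0) x (Matrix.vecCons (X x) w) := by
  rw [lieDer_toMultivector]
  exact (zero_add _).trans (iota_toMultivector_apply X (dForm α) 0 x w)

theorem lieDer_toMultivector_apply_succ (X : (x : M) → TangentSpace 𝓘(ℝ, E) x)
    (α : TotalForm E M) (q : ℕ) (x : M) (w : Fin (q + 1) → TangentSpace 𝓘(ℝ, E) x) :
    lieDer (toMultivector X) α (q + 1) x w =
      rawExtDeriv (iota (toMultivector X) α q) x w +
        rawExtDeriv (α (q + 1)) x (Matrix.vecCons (X x) w) := by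
  rw [lieDer_toMultivector]
  exact congrArg (_ + ·) (iota_toMultivector_apply X (dForm α) (q + 1) x w)

variable [IsManifold 𝓘(ℝ, E) ∞ M]

theorem chartRep_iota_toMultivector (X : (x : M) → TangentSpace 𝓘(ℝ, E) x) (α : TotalForm E M)
    (q : ℕ) (x₀ : M) {y : E} (hy : y ∈ (extChartAt 𝓘(ℝ, E) x₀).target) :
    chartRep (iota (toMultivector X) α q) x₀ y =
      (chartRep (α (q + 1)) x₀ y).curryLeft (chartField X x₀ y) := by
  ext w
  refine (iota_toMultivector_apply X α q _ _).trans ?_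
  change α (q + 1) ((extChartAt 𝓘(ℝ, E) x₀).symm y) _ =
    α (q + 1) ((extChartAt 𝓘(ℝ, E) x₀).symm y)
      (chartDiff x₀ y ∘ Matrix.vecCons (chartField X x₀ y) w)
  congr 1
  funext i
  refine Fin.cases ?_ (fun i => rfl) i
  exact (chartDiff_chartField X x₀ hy).symm

theorem dForm_mem_Omega {j : ℤ} {α : TotalForm E M} (hα : α ∈ Omega E M j) :
    dForm α ∈ Omega E M (j + 1) := by
  refine ⟨fun q => ?_, fun q hq => ?_⟩
  · cases q with
    | zero => exact (zero_mem (Omega E M 0)).1 0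
    | succ q => exact (hα.1 q).rawExtDeriv
  · cases q with
    | zero => rfl
    | succ q =>
      have h : α q = 0 := hα.2 q (by push_cast at hq; omega)
      change rawExtDeriv (α q) = 0
      rw [h, ← zero_smul ℝ (0 : RawForm E M q), rawExtDeriv_smul, zero_smul]

theorem dForm_dForm {j : ℤ} {α : TotalForm E M} (hα : α ∈ Omega E M j) :
    dForm (dForm α) = 0 := by
  funext q
  match q with
  | 0 => rfl
  | 1 =>
    change rawExtDeriv (0 : RawForm E M 0) = 0
    rw [← zero_smul ℝ (0 : RawForm E M 0), rawExtDeriv_smul, zero_smul]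
  | q + 2 => exact rawExtDeriv_rawExtDeriv (hα.1 q)

/-- The derivative depends only on the germ of the local expression; a free `θ` allows `α` to be
itself a contraction. -/
theorem rawExtDeriv_iota_toMultivector (X : (x : M) → TangentSpace 𝓘(ℝ, E) x) (α : TotalForm E M)
    (q : ℕ) (x : M) {θ : E → E [⋀^Fin (q + 1)]→L[ℝ] ℝ}
    (hθ : chartRep (α (q + 1)) x =ᶠ[𝓝 (extChartAt 𝓘(ℝ, E) x x)] θ) :
    rawExtDeriv (iota (toMultivector X) α q) x =
      extDeriv (fun z => (θ z).curryLeft (chartField X x z)) (extChartAt 𝓘(ℝ, E) x x) := by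
  rw [rawExtDeriv_self]
  refine Filter.EventuallyEq.extDeriv_eq ?_
  filter_upwards [hθ, (isOpen_extChartAt_target x).mem_nhds (mem_extChartAt_target x)] with z hz hz'
  rw [chartRep_iota_toMultivector X α q x hz', hz]

variable [CompleteSpace E]

theorem iota_vectorField_mem_Omega (X : VectorFields E M) {j : ℤ} {α : TotalForm E M}
    (hα : α ∈ Omega E M j) : iota (toMultivector X) α ∈ Omega E M (j - 1) := by
  refine ⟨fun q x₀ => ?_, fun q hq => ?_⟩
  · refine ContDiffOn.congr ?_ fun y hy => chartRep_iota_toMultivector X α q x₀ hy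
    exact ((curryLeftCLM ℝ E ℝ q).contDiff.comp_contDiffOn (hα.1 (q + 1) x₀)).clm_apply
      (contDiffOn_chartField X x₀)
  · funext x
    ext w
    rw [iota_toMultivector_apply, hα.2 (q + 1) (by push_cast; omega)]
    rfl

/-- The commutator of a Lie derivative and a contraction is the contraction with the bracket. -/
theorem lieDer_iota (X Y : VectorFields E M) {j : ℤ} {α : TotalForm E M}
    (hα : α ∈ Omega E M j) :
    lieDer (toMultivector X) (iota (toMultivector Y) α) =
      iota (toMultivector Y) (lieDer (toMultivector X) α) +
        iota (toMultivector (VectorField.mlieBracket 𝓘(ℝ, E) X Y)) α := by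
  have hXd (x : M) : DifferentiableAt ℝ (chartField X x) (extChartAt 𝓘(ℝ, E) x x) :=
    ((contDiffOn_chartField X x).contDiffAt
      ((isOpen_extChartAt_target x).mem_nhds (mem_extChartAt_target x))).differentiableAt (by simp)
  have hYd (x : M) : DifferentiableAt ℝ (chartField Y x) (extChartAt 𝓘(ℝ, E) x x) :=
    ((contDiffOn_chartField Y x).contDiffAt
      ((isOpen_extChartAt_target x).mem_nhds (mem_extChartAt_target x))).differentiableAt (by simp)
  funext q x
  ext w
  change _ = iota (toMultivector Y) (lieDer (toMultivector X) α) q x w +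
    iota (toMultivector (VectorField.mlieBracket 𝓘(ℝ, E) X Y)) α q x w
  rw [← sub_eq_iff_eq_add', iota_toMultivector_apply, iota_toMultivector_apply,
    mlieBracket_eq_lieBracket_chartField, ← chartRep_self (α (q + 1)) x]
  cases q with
  | zero =>
    rw [lieDer_toMultivector_apply_zero, lieDer_toMultivector_apply_succ,
      rawExtDeriv_iota_toMultivector X α 0 x .rfl, rawExtDeriv_iota_toMultivector Y α 0 x .rfl,
      rawExtDeriv_self (α 1), ← chartField_self X x, ← chartField_self Y x]
    exact extDeriv_commutator_zero ((hα.1 1).differentiableAt x) (hXd x) (hYd x) w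
  | succ q =>
    -- The term `d ι_X ι_Y α`, absent in degree `0`, needs the local expression of the double
    -- contraction.
    have h : chartRep (iota (toMultivector Y) α (q + 1)) x =ᶠ[𝓝 (extChartAt 𝓘(ℝ, E) x x)]
        fun z => (chartRep (α (q + 2)) x z).curryLeft (chartField Y x z) := by
      filter_upwards [(isOpen_extChartAt_target x).mem_nhds (mem_extChartAt_target x)] with z hz
      exact chartRep_iota_toMultivector Y α (q + 1) x hz
    rw [lieDer_toMultivector_apply_succ, lieDer_toMultivector_apply_succ,
      rawExtDeriv_iota_toMultivector X _ q x h, rawExtDeriv_iota_toMultivector X α (q + 1) x .rfl,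
      rawExtDeriv_iota_toMultivector Y α (q + 1) x .rfl,
      rawExtDeriv_self (α (q + 2)), ← chartField_self X x, ← chartField_self Y x]
    exact extDeriv_commutator_succ ((hα.1 (q + 2)).differentiableAt x) (hXd x) (hYd x) w

end FormCalculus

/-! ### The homology differential on decomposable elements -/

section Boundary

variable (𝔤 : Type*) [LieRing 𝔤] [LieAlgebra ℝ 𝔤]

theorem boundary_ιMulti (k : ℕ) (x : Fin (k + 2) → 𝔤) :
    boundary 𝔤 (k + 1) (exteriorPower.ιMulti ℝ (k + 2) x) =
      -∑ i : Fin (k + 1), ∑ j ≥ i, (-1 : ℝ) ^ (i + j : ℕ) •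
        exteriorPower.ιMulti ℝ (k + 1)
          (Matrix.vecCons ⁅x i.castSucc, x j.succ⁆ (j.removeNth (i.castSucc.removeNth x))) := by
  rw [boundary, exteriorPower.alternatingMapLinearEquiv_apply_ιMulti, boundaryAlt_apply]

theorem sum_Ici_succ {N : Type*} [AddCommMonoid N] {k : ℕ} (i : Fin k) (g : Fin (k + 1) → N) :
    ∑ j ≥ i.succ, g j = ∑ j ≥ i, g j.succ := by
  rw [← Fin.map_succEmb_Ici, Finset.sum_map]
  rfl

/-- Moving the entry at position `j` to the front passes `j` factors. These are the signs of the
pairs `(0, j)` in `boundary_ιMulti`. -/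
theorem ιMulti_update_eq {V : Type*} [AddCommGroup V] [Module ℝ V] {k : ℕ} (x : Fin (k + 1) → V)
    (j : Fin (k + 1)) (b : V) :
    exteriorPower.ιMulti ℝ (k + 1) (Function.update x j b) =
      (-1 : ℝ) ^ (j : ℕ) • exteriorPower.ιMulti ℝ (k + 1) (Matrix.vecCons b (j.removeNth x)) := by
  rw [← Fin.insertNth_removeNth, AlternatingMap.map_insertNth]
  rcases Nat.even_or_odd (j : ℕ) with h | h <;> rw [h.neg_one_pow, h.neg_one_pow] <;> module

end Boundary

/-! ### The extended Cartan formula for an infinitesimal action -/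

section Action

variable {E : Type*} [NormedAddCommGroup E] [NormedSpace ℝ E]
  {M : Type*} [TopologicalSpace M] [ChartedSpace E M] [IsManifold 𝓘(ℝ, E) ∞ M]
  {𝔤 : Type*} [LieRing 𝔤] [LieAlgebra ℝ 𝔤]

/-- The linear map `p ↦ ι(v_p) α`. -/
def iotaMulti (v : InfinitesimalAction E M 𝔤) (k : ℕ) (α : TotalForm E M) :
    (⋀[ℝ]^k 𝔤) →ₗ[ℝ] TotalForm E M where
  toFun p := iota (v.multi p) α
  map_add' p p' := by
    funext q x
    change contract (exteriorPower.map k (v.at' x) (p + p')) _ = _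
    rw [map_add, contract_add_left]
    rfl
  map_smul' c p := by
    funext q x
    change contract (exteriorPower.map k (v.at' x) (c • p)) _ = _
    rw [map_smul, contract_smul_left]
    rfl

theorem iotaMulti_apply (v : InfinitesimalAction E M 𝔤) (k : ℕ) (α : TotalForm E M)
    (p : ⋀[ℝ]^k 𝔤) : iotaMulti v k α p = iota (v.multi p) α := rfl

theorem iotaMulti_ιMulti_apply (v : InfinitesimalAction E M 𝔤) (k : ℕ) (α : TotalForm E M)
    (a : Fin k → 𝔤) (q : ℕ) (x : M) :
    iotaMulti v k α (exteriorPower.ιMulti ℝ k a) q x =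
      contractFamily (exteriorPower.ιMulti ℝ k fun i => v.field (a i) x) (fun q => α q x) q := by
  change contract (exteriorPower.map k (v.at' x) _) _ = _
  rw [exteriorPower.map_apply_ιMulti]
  rfl

theorem iotaMulti_zero (v : InfinitesimalAction E M 𝔤) (α : TotalForm E M) (a : Fin 0 → 𝔤) :
    iotaMulti v 0 α (exteriorPower.ιMulti ℝ 0 a) = α := by
  funext q x
  rw [iotaMulti_ιMulti_apply, contractFamily_zero]

theorem iotaMulti_vecCons (v : InfinitesimalAction E M 𝔤) (k : ℕ) (α : TotalForm E M)
    (b : 𝔤) (a : Fin k → 𝔤) :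
    iotaMulti v (k + 1) α (exteriorPower.ιMulti ℝ (k + 1) (Matrix.vecCons b a)) =
      iotaMulti v k (iota (toMultivector (v.field b)) α) (exteriorPower.ιMulti ℝ k a) := by
  funext q x
  rw [iotaMulti_ιMulti_apply, iotaMulti_ιMulti_apply]
  have h : (fun i => v.field (Matrix.vecCons b a i) x) =
      Matrix.vecCons (v.field b x) fun i => v.field (a i) x := by
    funext i
    refine Fin.cases rfl (fun _ => rfl) i
  rw [h, contractFamily_vecCons]
  rfl

theorem iotaMulti_add (v : InfinitesimalAction E M 𝔤) (k : ℕ) (α β : TotalForm E M) :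
    iotaMulti v k (α + β) = iotaMulti v k α + iotaMulti v k β :=
  LinearMap.ext fun _ => iota_add _ _ _

/-- `∂(b ∧ a) = -ad_b a - b ∧ ∂a`, after contraction. -/
theorem iotaMulti_boundary_vecCons (v : InfinitesimalAction E M 𝔤) (k : ℕ) (α : TotalForm E M)
    (b : 𝔤) (a : Fin (k + 1) → 𝔤) :
    iotaMulti v (k + 1) α
        (boundary 𝔤 (k + 1) (exteriorPower.ιMulti ℝ (k + 2) (Matrix.vecCons b a))) =
      -(∑ j, iotaMulti v (k + 1) α
        (exteriorPower.ιMulti ℝ (k + 1) (Function.update a j ⁅b, a j⁆))) -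
      iotaMulti v k (iota (toMultivector (v.field b)) α)
        (boundary 𝔤 k (exteriorPower.ιMulti ℝ (k + 1) a)) := by
  -- The pairs containing `b` assemble to `ad_b a`, the sum over all ways of replacing one factor `a
  -- j` by `⁅b, a j⁆`.
  have hfirst : ∑ j ≥ (0 : Fin (k + 1)), iotaMulti v (k + 1) α
      ((-1 : ℝ) ^ ((0 : Fin (k + 1)) + j : ℕ) • exteriorPower.ιMulti ℝ (k + 1) (Matrix.vecCons
        ⁅Matrix.vecCons b a (0 : Fin (k + 1)).castSucc, Matrix.vecCons b a j.succ⁆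
        (j.removeNth ((0 : Fin (k + 1)).castSucc.removeNth (Matrix.vecCons b a))))) =
      ∑ j, iotaMulti v (k + 1) α
        (exteriorPower.ιMulti ℝ (k + 1) (Function.update a j ⁅b, a j⁆)) := by
    refine Finset.sum_congr (by ext; simp) fun j _ => ?_
    rw [ιMulti_update_eq]
    simp [Fin.tail_def]
  rw [boundary_ιMulti, map_neg, map_sum]
  simp only [map_sum (iotaMulti v (k + 1) α)]
  rw [Fin.sum_univ_succ, hfirst, neg_add, ← sub_eq_add_neg]
  congr 1
  -- For `k = 0` there is no pair avoiding `b`, and `∂₁ = 0` on the other side.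
  cases k with
  | zero => simp [boundary]
  | succ k =>
    rw [boundary_ιMulti, map_neg, map_sum, ← Finset.sum_neg_distrib]
    refine Finset.sum_congr rfl fun i _ => ?_
    rw [map_sum, sum_Ici_succ, ← Finset.sum_neg_distrib]
    refine Finset.sum_congr rfl fun j _ => ?_
    -- For pairs avoiding `b` both indices are shifted by one, which does not change the sign;
    -- moving `b` in front of the bracket yields the minus sign.
    have h1 : i.succ.castSucc = i.castSucc.succ := rfl
    rw [h1, removeNth_succ_vecCons, removeNth_succ_vecCons, alternatingMap_vecCons_swap, smul_neg,
      map_neg, map_smul, map_smul, iotaMulti_vecCons]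
    simp only [Matrix.cons_val_succ, Fin.val_succ]
    rw [show (i + 1 + (j + 1) : ℕ) = i + j + 2 by ring, pow_add, neg_one_sq, mul_one]

variable [CompleteSpace E]

theorem iotaMulti_mem_Omega (v : InfinitesimalAction E M 𝔤) {k : ℕ} {j : ℤ} {α : TotalForm E M}
    (hα : α ∈ Omega E M j) (p : ⋀[ℝ]^k 𝔤) : iotaMulti v k α p ∈ Omega E M (j - k) := by
  induction p using exteriorPower_induction with
  | hι a =>
    induction k generalizing j α with
    | zero => rw [iotaMulti_zero]; simpa using hα
    | succ k ih =>
      obtain ⟨b, a, rfl⟩ : ∃ b z, a = Matrix.vecCons b z := ⟨a 0, Fin.tail a, by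
        rw [Matrix.vecCons, Fin.cons_self_tail]⟩
      rw [iotaMulti_vecCons]
      have h := ih (iota_vectorField_mem_Omega (v.field b) hα) a
      rwa [sub_sub, add_comm (1 : ℤ), ← Nat.cast_succ] at h
  | hadd p p' h h' => rw [map_add]; exact add_mem h h'
  | hsmul c p h => rw [map_smul]; exact Submodule.smul_mem _ c h

theorem lieDer_iota_field (v : InfinitesimalAction E M 𝔤) (b c : 𝔤) {j : ℤ} {α : TotalForm E M}
    (hα : α ∈ Omega E M j) :
    lieDer (toMultivector (v.field b)) (iota (toMultivector (v.field c)) α) =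
      iota (toMultivector (v.field c)) (lieDer (toMultivector (v.field b)) α) +
        iota (toMultivector (v.field ⁅b, c⁆)) α := by
  have h : (⇑(v.field ⁅b, c⁆) : (x : M) → TangentSpace 𝓘(ℝ, E) x) =
      VectorField.mlieBracket 𝓘(ℝ, E) (v.field b) (v.field c) := funext (v.map_lie b c)
  rw [lieDer_iota _ _ hα, h]

/-- Each contraction passed by `𝓛_{v_b}` contributes one bracket term, so the brackets add up to
`ad_b`, as for a derivation. -/
theorem lieDer_iotaMulti (v : InfinitesimalAction E M 𝔤) (b : 𝔤) {k : ℕ} {j : ℤ}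
    {α : TotalForm E M} (hα : α ∈ Omega E M j) (a : Fin k → 𝔤) :
    lieDer (toMultivector (v.field b)) (iotaMulti v k α (exteriorPower.ιMulti ℝ k a)) =
      iotaMulti v k (lieDer (toMultivector (v.field b)) α) (exteriorPower.ιMulti ℝ k a) +
        ∑ i, iotaMulti v k α (exteriorPower.ιMulti ℝ k (Function.update a i ⁅b, a i⁆)) := by
  induction k generalizing j α with
  | zero => simp [iotaMulti_zero]
  | succ k ih =>
    obtain ⟨c, a, rfl⟩ : ∃ c z, a = Matrix.vecCons c z := ⟨a 0, Fin.tail a, by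
      rw [Matrix.vecCons, Fin.cons_self_tail]⟩
    have h0 : Function.update (Matrix.vecCons c a) 0 ⁅b, c⁆ = Matrix.vecCons ⁅b, c⁆ a :=
      Fin.update_cons_zero _ _ _
    have hs (i : Fin k) : Function.update (Matrix.vecCons c a) i.succ ⁅b, a i⁆ =
        Matrix.vecCons c (Function.update a i ⁅b, a i⁆) := (Fin.cons_update _ _ _ _).symm
    rw [iotaMulti_vecCons, ih (iota_vectorField_mem_Omega (v.field c) hα),
      lieDer_iota_field v b c hα, iotaMulti_add, Fin.sum_univ_succ]
    simp only [Matrix.cons_val_zero, Matrix.cons_val_succ, h0, hs, iotaMulti_vecCons]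
    rw [LinearMap.add_apply, add_assoc]

/-- The extended Cartan formula for closed forms that are invariant under the action. -/
theorem dForm_iotaMulti_ιMulti (v : InfinitesimalAction E M 𝔤) {j : ℤ} {β : TotalForm E M}
    (hβ : β ∈ closedForms E M j)
    (hinv : ∀ a, dForm (iota (toMultivector (v.field a)) β) = 0) (k : ℕ) (a : Fin (k + 1) → 𝔤) :
    dForm (iotaMulti v (k + 1) β (exteriorPower.ιMulti ℝ (k + 1) a)) =
      (-1 : ℝ) ^ (k + 1) •
        iotaMulti v k β (boundary 𝔤 k (exteriorPower.ιMulti ℝ (k + 1) a)) := by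
  induction k with
  | zero =>
    obtain ⟨b, a, rfl⟩ : ∃ b z, a = Matrix.vecCons b z := ⟨a 0, Fin.tail a, by
      rw [Matrix.vecCons, Fin.cons_self_tail]⟩
    rw [iotaMulti_vecCons, iotaMulti_zero, hinv]
    simp [boundary]
  | succ k ih =>
    obtain ⟨b, a, rfl⟩ : ∃ b z, a = Matrix.vecCons b z := ⟨a 0, Fin.tail a, by
      rw [Matrix.vecCons, Fin.cons_self_tail]⟩
    have hL : lieDer (toMultivector (v.field b)) β = 0 := by
      rw [lieDer_toMultivector, hinv, hβ.2, iota_zero, add_zero]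
    -- With `γ = ι(v_a) β`, invariance of `β` leaves `𝓛_{v_b} γ = ι(v_{ad_b a}) β`. Cartan's formula
    -- and the induction hypothesis for `dγ` turn this into `d ι_{v_b} γ - ι(v_{∂a}) ι_{v_b} β =
    -- ι(v_{ad_b a}) β`; the sign is `(-1)^(k+1) (-1)^k = -1`.
    have hLγ := lieDer_iotaMulti v b hβ.1 a
    rw [hL, iotaMulti_apply v (k + 1) 0, iota_zero, zero_add, lieDer_toMultivector, ih a,
      iota_smul, iotaMulti_apply v k β, iota_toMultivector_comm, smul_smul, ← pow_add,
      Odd.neg_one_pow ⟨k, by ring⟩, ← iotaMulti_apply v k] at hLγ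
    -- `ι(v_{b ∧ a})` contracts with `v_b` first, whereas `hLγ` has `ι_{v_b}` outermost.
    have hγ : iotaMulti v (k + 2) β (exteriorPower.ιMulti ℝ (k + 2) (Matrix.vecCons b a)) =
        (-1 : ℝ) ^ (k + 1) • iota (toMultivector (v.field b))
          (iotaMulti v (k + 1) β (exteriorPower.ιMulti ℝ (k + 1) a)) := by
      rw [iotaMulti_vecCons, iotaMulti_apply v (k + 1) β, iota_toMultivector_comm, smul_smul,
        ← mul_pow, neg_one_mul, neg_neg, one_pow, one_smul]
      rfl
    rw [hγ, dForm_smul, iotaMulti_boundary_vecCons, ← hLγ, pow_succ _ (k + 1), mul_smul]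
    congr 1
    module

theorem dForm_iotaMulti (v : InfinitesimalAction E M 𝔤) {j : ℤ} {β : TotalForm E M}
    (hβ : β ∈ closedForms E M j)
    (hinv : ∀ a, dForm (iota (toMultivector (v.field a)) β) = 0) (k : ℕ) (p : ⋀[ℝ]^(k + 1) 𝔤) :
    dForm (iotaMulti v (k + 1) β p) = (-1 : ℝ) ^ (k + 1) • iotaMulti v k β (boundary 𝔤 k p) := by
  induction p using exteriorPower_induction with
  | hι a => exact dForm_iotaMulti_ιMulti v hβ hinv k a
  | hadd p p' h h' =>
    rw [map_add, dForm_add (iotaMulti_mem_Omega v hβ.1 p).1 (iotaMulti_mem_Omega v hβ.1 p').1, h,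
      h', map_add, map_add, smul_add]
  | hsmul c p h => rw [map_smul, dForm_smul, h, map_smul, map_smul, smul_comm]

end Action

/-! ### Closedness, exactness and co-momentum maps -/

section Moment

variable {E : Type*} [NormedAddCommGroup E] [NormedSpace ℝ E]
  {M : Type*} [TopologicalSpace M] [ChartedSpace E M]

theorem eq_zero_of_mem_Omega_of_neg {j : ℤ} (hj : j < 0) {α : TotalForm E M}
    (hα : α ∈ Omega E M j) : α = 0 :=
  funext fun q => hα.2 q (by omega)

theorem sgn_mul_self (k : ℕ) : sgn k * sgn k = 1 := by
  rw [sgn, neg_mul_neg, ← mul_pow, neg_one_mul, neg_neg, one_pow]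

variable [IsManifold 𝓘(ℝ, E) ∞ M] {𝔤 : Type*} [LieRing 𝔤] [LieAlgebra ℝ 𝔤]

theorem lieDer_multi (v : InfinitesimalAction E M 𝔤) {k : ℕ} (p : ⋀[ℝ]^k 𝔤) (H : TotalForm E M) :
    lieDer (v.multi p) H =
      dForm (iotaMulti v k H p) - (-1 : ℝ) ^ k • iotaMulti v k (dForm H) p := rfl

theorem dForm_mem_closedForms {j : ℤ} {α : TotalForm E M} (hα : α ∈ Omega E M j) :
    dForm α ∈ closedForms E M (j + 1) :=
  ⟨dForm_mem_Omega hα, dForm_dForm hα⟩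

theorem lieDer_multi_smul (v : InfinitesimalAction E M 𝔤) (H : TotalForm E M) {k : ℕ} (c : ℝ)
    (p : ⋀[ℝ]^k 𝔤) : lieDer (v.multi (c • p)) H = c • lieDer (v.multi p) H := by
  simp only [lieDer_multi, map_smul]
  rw [dForm_smul]
  module

variable [CompleteSpace E]

/-- The summand `d ι_{v_a} H` of `𝓛_{v_a} H` is killed by `d`. This supplies the invariance of `dH`
for the extended Cartan formula. -/
theorem dForm_iota_dForm_eq_zero {v : InfinitesimalAction E M 𝔤} {j : ℤ} {H : TotalForm E M}
    (hH : H ∈ Omega E M j) (hloc : v.IsLocallyPreserving H) (a : 𝔤) :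
    dForm (iota (toMultivector (v.field a)) (dForm H)) = 0 := by
  have h := hloc a
  have h1 := iota_vectorField_mem_Omega (v.field a) hH
  rwa [lieDer_toMultivector, dForm_add (dForm_mem_Omega h1).1
    (iota_vectorField_mem_Omega (v.field a) (dForm_mem_Omega hH)).1, dForm_dForm h1,
    zero_add] at h

theorem iotaMulti_dForm_mem_closedForms {v : InfinitesimalAction E M 𝔤} {j : ℤ}
    {H : TotalForm E M} (hH : H ∈ Omega E M j) (hloc : v.IsLocallyPreserving H) {k : ℕ}
    {p : ⋀[ℝ]^(k + 1) 𝔤} (hp : boundary 𝔤 k p = 0) :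
    iotaMulti v (k + 1) (dForm H) p ∈ closedForms E M (j - k) := by
  have h := iotaMulti_mem_Omega v (dForm_mem_Omega hH) p
  refine ⟨by convert h using 2; push_cast; ring, ?_⟩
  rw [dForm_iotaMulti v (dForm_mem_closedForms hH) (dForm_iota_dForm_eq_zero hH hloc), hp, map_zero,
    smul_zero]

theorem dForm_iotaMulti_mem_closedForms (v : InfinitesimalAction E M 𝔤) {j : ℤ}
    {H : TotalForm E M} (hH : H ∈ Omega E M j) {k : ℕ} (p : ⋀[ℝ]^(k + 1) 𝔤) :
    dForm (iotaMulti v (k + 1) H p) ∈ closedForms E M (j - k) := by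
  have h := dForm_mem_closedForms (iotaMulti_mem_Omega v hH p)
  convert h using 2
  push_cast
  ring

theorem lieDer_multi_mem_closedForms {v : InfinitesimalAction E M 𝔤} {j : ℤ}
    {H : TotalForm E M} (hH : H ∈ Omega E M j) (hloc : v.IsLocallyPreserving H) {k : ℕ}
    {p : ⋀[ℝ]^(k + 1) 𝔤} (hp : boundary 𝔤 k p = 0) :
    lieDer (v.multi p) H ∈ closedForms E M (j - k) := by
  rw [lieDer_multi]
  exact sub_mem (dForm_iotaMulti_mem_closedForms v hH p)
    (Submodule.smul_mem _ _ (iotaMulti_dForm_mem_closedForms hH hloc hp))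

theorem lieDer_multi_boundary_mem_exactForms {v : InfinitesimalAction E M 𝔤} {j : ℤ}
    {H : TotalForm E M} (hH : H ∈ Omega E M j) (hloc : v.IsLocallyPreserving H) {k : ℕ}
    (p : ⋀[ℝ]^(k + 2) 𝔤) :
    lieDer (v.multi (boundary 𝔤 (k + 1) p)) H ∈ exactForms E M (j - k) := by
  have h1 : iotaMulti v (k + 1) H (boundary 𝔤 (k + 1) p) ∈ Omega E M (j - k - 1) := by
    convert iotaMulti_mem_Omega v hH (boundary 𝔤 (k + 1) p) using 2
    push_cast
    ring
  have h2 : iotaMulti v (k + 2) (dForm H) p ∈ Omega E M (j - k - 1) := by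
    convert iotaMulti_mem_Omega v (dForm_mem_Omega hH) p using 2
    push_cast
    ring
  -- The primitive is `ι(v_{∂p}) H + ι(v_p) dH`; the extended Cartan formula turns `d` of the second
  -- summand into the second term of `𝓛_{v_{∂p}} H`.
  refine ⟨_, add_mem h1 h2, ?_⟩
  rw [dForm_add h1.1 h2.1, dForm_iotaMulti v (dForm_mem_closedForms hH)
    (dForm_iota_dForm_eq_zero hH hloc), lieDer_multi, pow_succ _ (k + 1)]
  module

theorem lieDer_multi_add (v : InfinitesimalAction E M 𝔤) {j : ℤ} {H : TotalForm E M}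
    (hH : H ∈ Omega E M j) {k : ℕ} (p p' : ⋀[ℝ]^k 𝔤) :
    lieDer (v.multi (p + p')) H = lieDer (v.multi p) H + lieDer (v.multi p') H := by
  simp only [lieDer_multi, map_add]
  rw [dForm_add (iotaMulti_mem_Omega v hH p).1 (iotaMulti_mem_Omega v hH p').1]
  module

/-- The map `p ↦ 𝓛_{v_p} H` from cycles to closed forms. -/
def lieDerCycles (v : InfinitesimalAction E M 𝔤) {n : ℕ} {H : TotalForm E M}
    (hH : H ∈ Omega E M (n - 1)) (hloc : v.IsLocallyPreserving H) (k : ℕ) :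
    cycles 𝔤 (k + 1) →ₗ[ℝ] closedForms E M ((n : ℤ) - (k + 1 : ℕ)) where
  toFun p := ⟨lieDer (v.multi (p : ⋀[ℝ]^(k + 1) 𝔤)) H, by
    convert lieDer_multi_mem_closedForms hH hloc p.2 using 2
    push_cast
    ring⟩
  map_add' p p' := Subtype.ext (lieDer_multi_add v hH _ _)
  map_smul' c p := Subtype.ext (lieDer_multi_smul v H c _)

/-- The map `[p] ↦ [𝓛_{v_p} H]` from Lie algebra homology to de Rham cohomology. -/
def lieDerHomology (v : InfinitesimalAction E M 𝔤) {n : ℕ} {H : TotalForm E M}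
    (hH : H ∈ Omega E M (n - 1)) (hloc : v.IsLocallyPreserving H) (k : ℕ) :
    LieHomology 𝔤 (k + 1) →ₗ[ℝ] DeRham E M ((n : ℤ) - (k + 1 : ℕ)) :=
  Submodule.mapQ _ _ (lieDerCycles v hH hloc k) <| by
    rintro ⟨p, hp⟩ ⟨r, hr⟩
    change boundary 𝔤 (k + 1) r = p at hr
    subst hr
    change lieDer (v.multi (boundary 𝔤 (k + 1) r)) H ∈ exactForms E M _
    convert lieDer_multi_boundary_mem_exactForms hH hloc r using 2
    push_cast
    ring

theorem IsComomentum.dForm_apply_cycle {n : ℕ} {θ : TotalForm E M} (hθ : θ ∈ Omega E M (n + 1))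
    {v : InfinitesimalAction E M 𝔤} {f : (i : ℕ) → (⋀[ℝ]^i 𝔤) →ₗ[ℝ] Omega E M ((n : ℤ) - i)}
    -- The defining equation covers degrees up to `n + 1`; above that, both sides are forms of
    -- negative degree.
    (hf : IsComomentum n θ v f) {k : ℕ} {p : ⋀[ℝ]^(k + 1) 𝔤} (hp : boundary 𝔤 k p = 0) :
    dForm (f (k + 1) p : TotalForm E M) = -(sgn (k + 1) • iotaMulti v (k + 1) θ p) := by
  by_cases hk : k ≤ n
  · have h := hf.main k hk p
    rw [hp, map_zero, ZeroMemClass.coe_zero, neg_zero] at h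
    exact eq_neg_of_add_eq_zero_left h.symm
  · have h1 : (f (k + 1) p : TotalForm E M) = 0 :=
      eq_zero_of_mem_Omega_of_neg (by push_cast; omega) (f (k + 1) p).2
    have h2 : iotaMulti v (k + 1) θ p = 0 :=
      eq_zero_of_mem_Omega_of_neg (by push_cast; omega) (iotaMulti_mem_Omega v hθ p)
    rw [h1, h2, dForm_zero, smul_zero, neg_zero]

/-- The Lie derivative of the momenta along a Hamiltonian vector field. -/
theorem IsComomentum.lieDer_apply_cycle {n : ℕ} {θ : TotalForm E M} (hθ : θ ∈ Omega E M (n + 1))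
    {v : InfinitesimalAction E M 𝔤} {f : (i : ℕ) → (⋀[ℝ]^i 𝔤) →ₗ[ℝ] Omega E M ((n : ℤ) - i)}
    (hf : IsComomentum n θ v f) {H : TotalForm E M} {X : VectorFields E M}
    (hX : IsHamiltonianVectorField θ H X) {k : ℕ} {p : ⋀[ℝ]^(k + 1) 𝔤}
    (hp : boundary 𝔤 k p = 0) :
    lieDer (toMultivector X) (f (k + 1) p) =
      dForm (iota (toMultivector X) (f (k + 1) p : TotalForm E M)) +
        (sgn (k + 1) * (-1 : ℝ) ^ (k + 1)) • iotaMulti v (k + 1) (dForm H) p := by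
  rw [lieDer_toMultivector, hf.dForm_apply_cycle hθ hp, hX, iota_neg, iota_smul, iotaMulti_apply,
    iota_toMultivector_comm, iotaMulti_apply, iota_neg]
  module

end Moment

end MultiSymp

end

/-! ### The main theorem -/

open MultiSymp in
theorem mainTheorem8
    {E : Type*} [NormedAddCommGroup E] [NormedSpace ℝ E] [FiniteDimensional ℝ E]
    {M : Type*} [TopologicalSpace M] [ChartedSpace E M] [IsManifold 𝓘(ℝ, E) ∞ M]
    {𝔤 : Type*} [LieRing 𝔤] [LieAlgebra ℝ 𝔤]
    (n : ℕ) (ω₀ : TotalForm E M) (hω : IsPrePlectic n ω₀)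
    (H : TotalForm E M) (hH : IsHamiltonianForm n ω₀ H)
    (v : InfinitesimalAction E M 𝔤) (hv : v.IsMultisymplectic ω₀)
    (hloc : v.IsLocallyPreserving H)
    (k : ℕ) (hk : 1 ≤ k) :
    ∃ A : LieHomology 𝔤 k →ₗ[ℝ] DeRham E M ((n : ℤ) - k),
      (∀ p : cycles 𝔤 k,
        ∃ hcl : lieDer (v.multi (p : ⋀[ℝ]^k 𝔤)) H ∈ closedForms E M ((n : ℤ) - k),
          A (Subquotient.mk p) = Subquotient.mk ⟨lieDer (v.multi (p : ⋀[ℝ]^k 𝔤)) H, hcl⟩) ∧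
      (∀ vH : VectorFields E M, IsHamiltonianVectorField ω₀ H vH →
        ∀ f : (i : ℕ) → (⋀[ℝ]^i 𝔤) →ₗ[ℝ] Omega E M ((n : ℤ) - i), IsComomentum n ω₀ v f →
          ∀ p : cycles 𝔤 k,
            ∃ hcl : lieDer (toMultivector vH) (f k p) ∈ closedForms E M ((n : ℤ) - k),
              A (Subquotient.mk p) =
                -sgn k • Subquotient.mk ⟨lieDer (toMultivector vH) (f k p), hcl⟩) := by
  obtain ⟨k, rfl⟩ : ∃ l, k = l + 1 := ⟨k - 1, by omega⟩
  have : CompleteSpace E := FiniteDimensional.complete ℝ E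
  refine ⟨lieDerHomology v hH.1 hloc k, fun p => ⟨(lieDerCycles v hH.1 hloc k p).2, rfl⟩,
    fun vH hvH f hf p => ?_⟩
  have hι := iota_vectorField_mem_Omega vH (f (k + 1) p).2
  have hL := hf.lieDer_apply_cycle hω.1 hvH p.2
  have hι' : iotaMulti v (k + 1) H p ∈ Omega E M ((n : ℤ) - (k + 1 : ℕ) - 1) := by
    convert iotaMulti_mem_Omega v hH.1 (p : ⋀[ℝ]^(k + 1) 𝔤) using 2
    ring
  have hcl : lieDer (toMultivector vH) (f (k + 1) p) ∈
      closedForms E M ((n : ℤ) - (k + 1 : ℕ)) := by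
    rw [hL]
    refine add_mem ?_ (Submodule.smul_mem _ _ ?_)
    · convert dForm_mem_closedForms hι using 2
      ring
    · convert iotaMulti_dForm_mem_closedForms hH.1 hloc p.2 using 2
      push_cast
      ring
  refine ⟨hcl, ?_⟩
  rw [← map_smul]
  -- The difference of the two representatives has the primitive `ι(v_p) H + ς(k) ι_{v_H} f_k(p)`,
  -- with `k` now written as `k + 1`.
  refine (Submodule.Quotient.eq _).2
    ⟨_, add_mem hι' (Submodule.smul_mem _ (sgn (k + 1)) hι), ?_⟩
  rw [dForm_add hι'.1 (Submodule.smul_mem _ (sgn (k + 1)) hι).1, dForm_smul]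
  change _ = lieDer (v.multi (p : ⋀[ℝ]^(k + 1) 𝔤)) H -
    (-sgn (k + 1)) • lieDer (toMultivector vH) (f (k + 1) p)
  -- `ς² = 1` makes the two multiples of `ι(v_p) dH` cancel.
  rw [hL, lieDer_multi, smul_add, smul_smul, ← mul_assoc, neg_mul, sgn_mul_self]
  module
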